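/- Let $n\ge 3$, let $(M,g)$ be a connected smooth $n$-dimensional Riemannian manifold (without boundary), and let $r$, $s$ and $z=r-\frac sn g$ denote its Ricci, scalar and traceless Ricci curvature. Curvature signs are such that $R(X,Y,X,Y)$ is the sectional curvature of an orthonormal pair, and the Weyl tensor $\mathcal W$ is given by $R=\frac{s}{2n(n-1)}\,g\owedge g+\frac1{n-2}\,z\owedge g+\mathcal W$, where $\owedge$ is the Kulkarni–Nomizu product. For a $1$-form $\phi$ and a symmetric $2$-tensor $\eta$ put $(\phi\wedge\eta)(X,Y,Z)=\phi(X)\eta(Y,Z)-\phi(Y)\eta(X,Z)$. Suppose that $(M,g,f)$ is a vacuum static space, i.e. $f:M\to\mathbb R$ is a smooth function, not identically zero, with $$Ddf-\Bigl(r-\frac{s}{n-1}\,g\Bigr)f=0 .$$ Let $$C(X,Y,Z)=(D_Xr)(Y,Z)-(D_Yr)(X,Z)-\frac1{2(n-1)}\,(ds\wedge g)(X,Y,Z)$$ be the Cotton tensor, let $$B(X,Y)=\frac1{n-3}\sum_{k,l}(D^2_{E_k,E_l}\mathcal W)(X,E_k,Y,E_l)+\frac1{n-2}\sum_{k,l}\mathcal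 W(X,E_k,Y,E_l)\,r(E_k,E_l)$$ be the Bach tensor, where $\{E_i\}$ is an orthonormal frame (for $n=3$, where $\mathcal W=0$, $B(X,Y)=\sum_i (D_{E_i}C)(E_i,X,Y)$), and let $$T=\frac1{n-2}\,df\wedge z+\frac1{(n-1)(n-2)}\,z(\nabla f,\cdot)\wedge g .$$ Assume that the complete divergence of the Bach tensor vanishes: $\operatorname{div}^2B=\sum_{i,j}(D^2_{E_i,E_j}B)(E_j,E_i)=0$ on $M$. If $T=0$ on $M$, then $B=0$ and $C=0$ on $M$. -/

import Mathlib

open scoped Manifold ContDiff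

noncomputable section

namespace StaticSpace

/-! ### Riemannian geometry in local coordinates

`G` is the matrix `(g_ij)` of a metric in a coordinate system, as a function on (an open part of)
`ℝⁿ`; all tensors are covariant and given by their components. -/

/-- The coordinate space `ℝⁿ`. -/
abbrev Coord (n : ℕ) : Type := EuclideanSpace ℝ (Fin n)

/-- A matrix field on the coordinate space: the components `g_ij` of a metric. -/
abbrev CoordMetric (n : ℕ) : Type := Coord n → Matrix (Fin n) (Fin n) ℝ

section Local

variable {n : ℕ}

/-- The partial derivative `∂_i F`. -/
def pd (i : Fin n) (F : Coord n → ℝ) (y : Coord n) : ℝ :=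
  fderiv ℝ F y (EuclideanSpace.single i 1)

/-- The components `g^{ij}` of the inverse metric. -/
def ginv (G : CoordMetric n) (i j : Fin n) (y : Coord n) : ℝ :=
  (G y)⁻¹ i j

/-- The Christoffel symbols `Γ^k_{ij}` of the Levi-Civita connection. -/
def christoffel (G : CoordMetric n) (k i j : Fin n) (y : Coord n) : ℝ :=
  (1 / 2) * ∑ l, ginv G k l y *
    (pd i (fun x => G x j l) y + pd j (fun x => G x i l) y - pd l (fun x => G x i j) y)

/-- `D_i φ_j`, the covariant derivative of a `1`-form. -/
def cov1 (G : CoordMetric n) (φ : Fin n → Coord n → ℝ) (i j : Fin n) (y : Coord n) : ℝ :=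
  pd i (φ j) y - ∑ m, christoffel G m i j y * φ m y

/-- `D_i h_{jk}`, the covariant derivative of a `2`-tensor. -/
def cov2 (G : CoordMetric n) (h : Fin n → Fin n → Coord n → ℝ) (i j k : Fin n)
    (y : Coord n) : ℝ :=
  pd i (h j k) y
    - ∑ m, (christoffel G m i j y * h m k y + christoffel G m i k y * h j m y)

/-- `D_i A_{jkl}`, the covariant derivative of a `3`-tensor. -/
def cov3 (G : CoordMetric n) (A : Fin n → Fin n → Fin n → Coord n → ℝ) (i j k l : Fin n)
    (y : Coord n) : ℝ :=
  pd i (A j k l) y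
    - ∑ m, (christoffel G m i j y * A m k l y + christoffel G m i k y * A j m l y
        + christoffel G m i l y * A j k m y)

/-- `D_i Q_{jklp}`, the covariant derivative of a `4`-tensor. -/
def cov4 (G : CoordMetric n) (Q : Fin n → Fin n → Fin n → Fin n → Coord n → ℝ)
    (i j k l p : Fin n) (y : Coord n) : ℝ :=
  pd i (Q j k l p) y
    - ∑ m, (christoffel G m i j y * Q m k l p y + christoffel G m i k y * Q j m l p y
        + christoffel G m i l y * Q j k m p y + christoffel G m i p y * Q j k l m y)

/-- The Riemann tensor `R_{ijkl}`, with the sign for which `R(X, Y, X, Y)` is the sectional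
curvature of an orthonormal pair, i.e. `R(X, Y)Z = D_{[X,Y]} Z - [D_X, D_Y] Z`. -/
def riem (G : CoordMetric n) (i j k l : Fin n) (y : Coord n) : ℝ :=
  ∑ m, G y l m *
    (pd j (christoffel G m i k) y - pd i (christoffel G m j k) y
      + ∑ p, (christoffel G p i k y * christoffel G m j p y
          - christoffel G p j k y * christoffel G m i p y))

/-- The Ricci tensor `r_{jl} = g^{ik} R_{ijkl}`. -/
def ric (G : CoordMetric n) (j l : Fin n) (y : Coord n) : ℝ :=
  ∑ i, ∑ k, ginv G i k y * riem G i j k l y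

/-- The scalar curvature `s`. -/
def scal (G : CoordMetric n) (y : Coord n) : ℝ :=
  ∑ j, ∑ l, ginv G j l y * ric G j l y

/-- The traceless Ricci tensor `z = r - (s/n) g`. -/
def tracelessRic (G : CoordMetric n) (i j : Fin n) (y : Coord n) : ℝ :=
  ric G i j y - scal G y / (n : ℝ) * G y i j

/-- The Weyl tensor, from the decomposition
`R = s/(2n(n-1)) g ∧ g + 1/(n-2) z ∧ g + W` with the Kulkarni-Nomizu product. -/
def weyl (G : CoordMetric n) (i j k l : Fin n) (y : Coord n) : ℝ :=
  riem G i j k l y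
    - scal G y / ((n : ℝ) * ((n : ℝ) - 1)) * (G y i k * G y j l - G y i l * G y j k)
    - 1 / ((n : ℝ) - 2) *
      (tracelessRic G i k y * G y j l + tracelessRic G j l y * G y i k
        - tracelessRic G i l y * G y j k - tracelessRic G j k y * G y i l)

/-- The Cotton tensor `C = d^D r - 1/(2(n-1)) ds ∧ g`, where
`(φ ∧ η)(X, Y, Z) = φ(X) η(Y, Z) - φ(Y) η(X, Z)`. -/
def cotton (G : CoordMetric n) (i j k : Fin n) (y : Coord n) : ℝ :=
  cov2 G (ric G) i j k y - cov2 G (ric G) j i k y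
    - 1 / (2 * ((n : ℝ) - 1)) * (pd i (scal G) y * G y j k - pd j (scal G) y * G y i k)

/-- `(div C)(X, Y) = ∑ (D_{E_i} C)(E_i, X, Y)`. -/
def divCotton (G : CoordMetric n) (i j : Fin n) (y : Coord n) : ℝ :=
  ∑ k, ∑ l, ginv G k l y * cov3 G (cotton G) k l i j y

/-- The divergence of the Weyl tensor in its last slot, `∑ (D_{E_l} W)(X, Y, Z, E_l)`. -/
def divWeyl (G : CoordMetric n) (i j k : Fin n) (y : Coord n) : ℝ :=
  ∑ p, ∑ l, ginv G p l y * cov4 G (weyl G) p i j k l y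

/-- The double divergence of the Weyl tensor, `∑ (D²_{E_k, E_l} W)(X, E_k, Y, E_l)`. -/
def divDivWeyl (G : CoordMetric n) (i j : Fin n) (y : Coord n) : ℝ :=
  ∑ p, ∑ k, ginv G p k y * cov3 G (divWeyl G) p i k j y

/-- The contraction `∑ r(W(X, E_i)Y, E_i) = ∑ W(X, E_i, Y, E_j) r(E_i, E_j)`. -/
def weylRic (G : CoordMetric n) (i j : Fin n) (y : Coord n) : ℝ :=
  ∑ k, ∑ l, ∑ p, ∑ q, ginv G k p y * ginv G l q y * weyl G i k j l y * ric G p q y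

/-- The Bach tensor: for `n ≥ 4` it is `1/(n-3) div div W + 1/(n-2) W(r)`. In dimension three, where
the Weyl tensor vanishes and the first coefficient is meaningless, the double divergence term is
replaced as usual by `1/(n-2) div C`, to which it is equal for `n ≥ 4`. -/
def bach (G : CoordMetric n) (i j : Fin n) (y : Coord n) : ℝ :=
  (if n = 3 then 1 / ((n : ℝ) - 2) * divCotton G i j y
    else 1 / ((n : ℝ) - 3) * divDivWeyl G i j y)
  + 1 / ((n : ℝ) - 2) * weylRic G i j y

/-- The divergence of the Bach tensor. -/
def divBach (G : CoordMetric n) (j : Fin n) (y : Coord n) : ℝ :=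
  ∑ k, ∑ l, ginv G k l y * cov2 G (bach G) k l j y

/-- The complete divergence `div² B` of the Bach tensor. -/
def divDivBach (G : CoordMetric n) (y : Coord n) : ℝ :=
  ∑ k, ∑ l, ginv G k l y * cov1 G (divBach G) k l y

/-- The Hessian `Ddf`. -/
def hess (G : CoordMetric n) (u : Coord n → ℝ) (i j : Fin n) (y : Coord n) : ℝ :=
  cov1 G (fun k => pd k u) i j y

/-- The `1`-form `z(∇f, ·)`. -/
def gradTracelessRic (G : CoordMetric n) (u : Coord n → ℝ) (i : Fin n) (y : Coord n) : ℝ :=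
  ∑ a, ∑ b, ginv G a b y * pd a u y * tracelessRic G b i y

/-- The tensor `T = 1/(n-2) df ∧ z + 1/((n-1)(n-2)) z(∇f, ·) ∧ g`. -/
def tensorT (G : CoordMetric n) (u : Coord n → ℝ) (i j k : Fin n) (y : Coord n) : ℝ :=
  1 / ((n : ℝ) - 2) * (pd i u y * tracelessRic G j k y - pd j u y * tracelessRic G i k y)
    + 1 / (((n : ℝ) - 1) * ((n : ℝ) - 2)) *
      (gradTracelessRic G u i y * G y j k - gradTracelessRic G u j y * G y i k)

end Local

/-! ### Riemannian manifolds

A tensor field on `M` vanishes when its components vanish in every chart of the smooth structure,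
at every point of the chart. -/

section Global

variable {n : ℕ} {M : Type*} [TopologicalSpace M] [ChartedSpace (Coord n) M]
  [IsManifold (𝓡 n) ∞ M]

/-- Smooth Riemannian metrics on `M`. -/
abbrev Metric (n : ℕ) (M : Type*) [TopologicalSpace M] [ChartedSpace (Coord n) M]
    [IsManifold (𝓡 n) ∞ M] : Type _ :=
  Bundle.ContMDiffRiemannianMetric (𝓡 n) ∞ (Coord n) (fun x : M => TangentSpace (𝓡 n) x)

/-- The coordinate vector field `∂_i` of the chart `e`, at the point with coordinates `y`. -/
def coordVec (e : OpenPartialHomeomorph M (Coord n)) (i : Fin n) (y : Coord n) :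
    TangentSpace (𝓡 n) (e.symm y) :=
  mfderiv (𝓡 n) (𝓡 n) e.symm y (EuclideanSpace.single i 1 : Coord n)

/-- The components `g(∂_i, ∂_j)` of the metric in the chart `e`. -/
def metricIn (g : Metric n M) (e : OpenPartialHomeomorph M (Coord n)) : CoordMetric n :=
  fun y => Matrix.of fun i j => g.inner (e.symm y) (coordVec e i y) (coordVec e j y)

/-- The function `f` in the chart `e`. -/
def funIn (f : M → ℝ) (e : OpenPartialHomeomorph M (Coord n)) : Coord n → ℝ :=
  fun y => f (e.symm y)

/-- `(M, g, f)` is a vacuum static space: `f` is smooth, not identically zero, and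
`Ddf - (r - s/(n-1) g) f = 0`. -/
structure IsVacuumStatic (g : Metric n M) (f : M → ℝ) : Prop where
  smooth : ContMDiff (𝓡 n) 𝓘(ℝ, ℝ) ∞ f
  nontrivial : ∃ x, f x ≠ 0
  static : ∀ e ∈ IsManifold.maximalAtlas (𝓡 n) ∞ M, ∀ y ∈ e.target, ∀ i j,
    hess (metricIn g e) (funIn f e) i j y
      - (ric (metricIn g e) i j y - scal (metricIn g e) y / ((n : ℝ) - 1) * metricIn g e y i j)
        * funIn f e y = 0

/-- `T = 0` on `M`. -/
def TensorTVanishes (g : Metric n M) (f : M → ℝ) : Prop :=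
  ∀ e ∈ IsManifold.maximalAtlas (𝓡 n) ∞ M, ∀ y ∈ e.target, ∀ i j k,
    tensorT (metricIn g e) (funIn f e) i j k y = 0

/-- `C = 0` on `M`. -/
def CottonVanishes (g : Metric n M) : Prop :=
  ∀ e ∈ IsManifold.maximalAtlas (𝓡 n) ∞ M, ∀ y ∈ e.target, ∀ i j k,
    cotton (metricIn g e) i j k y = 0

/-- `B = 0` on `M`. -/
def BachVanishes (g : Metric n M) : Prop :=
  ∀ e ∈ IsManifold.maximalAtlas (𝓡 n) ∞ M, ∀ y ∈ e.target, ∀ i j,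
    bach (metricIn g e) i j y = 0

/-- `div² B = 0` on `M`. -/
def DivDivBachVanishes (g : Metric n M) : Prop :=
  ∀ e ∈ IsManifold.maximalAtlas (𝓡 n) ∞ M, ∀ y ∈ e.target,
    divDivBach (metricIn g e) y = 0

end Global

end StaticSpace

end

namespace StaticSpace

open Filter Topology Matrix Bundle

variable {n : ℕ} {U : Set (Coord n)} {y : Coord n} {G : CoordMetric n} {u : Coord n → ℝ}

/-! ### Partial derivatives -/

/-! Write u for the potential. The Ricci identity turns the antisymmetrized derivative of the static
equation into a formula for R(·,·,·,∇u). Its trace, together with the contracted Bianchi identity,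
gives u ds = 0. Inserting the Weyl decomposition gives the central identity W(·,·,·,∇u) = u C +
(n-1) T wherever ds = 0.

Suppose T = 0. Where u and du do not vanish, two facts combine. Algebraically, T = 0 forces z = a
du⊗du + b g. By the central identity and the antisymmetry of W, C(·,·,∇u) = 0. Differentiating r = z
+ (s/n) g and using the static equation for Ddu gives C = (da∧du)⊗du + μ∧g for a 1-form μ. Since C
is trace free and C(·,·,∇u) = 0, a small linear system forces da∧du = 0 and μ = 0, hence C = 0. The
central identity then reads W(·,·,·,∇u) = 0; as W is trace free and r is a combination of du⊗du and
g, the contraction W(r) vanishes too. On an open set where u ≠ 0 and du = 0, the static equation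
makes r a multiple of g, and its trace forces r = 0.

So every open set on which u is not identically zero contains a point with C = 0 and W(r) = 0, and
continuity removes the exceptional points once the zeros of u have empty interior. This is unique
continuation: the static equation is a linear first-order system for the 1-jet (u, du) along
segments, so Grönwall makes the interior of the zero set closed, and M is connected. Finally, with
ds = 0 and C = 0 throughout, the second Bianchi identity gives div W = 0, and B reduces to a
multiple of W(r).

The carrying lemmas are `sum_grad_mul_weyl`, `tracelessRic_eq_of_tensorT`, `cotton_eq_zero`,
`bach_eq` and `eq_zero_of_segment`. -/

theorem pd_congr {F H : Coord n → ℝ} (i : Fin n) (h : F =ᶠ[𝓝 y] H) : pd i F y = pd i H y := by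
  simp only [pd, h.fderiv_eq]

theorem pd_congr_on {F H : Coord n → ℝ} (hU : IsOpen U) (h : ∀ x ∈ U, F x = H x) (hy : y ∈ U)
    (i : Fin n) : pd i F y = pd i H y :=
  pd_congr i (eventually_of_mem (hU.mem_nhds hy) h)

theorem pd_const (i : Fin n) (c : ℝ) (y : Coord n) : pd i (fun _ => c) y = 0 := by
  simp [pd]

theorem pd_eq_zero_of_on {F : Coord n → ℝ} (hU : IsOpen U) (h : ∀ x ∈ U, F x = 0) (hy : y ∈ U)
    (i : Fin n) : pd i F y = 0 := by
  rw [pd_congr_on hU h hy, pd_const]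

theorem pd_add {F H : Coord n → ℝ} (i : Fin n) (hF : DifferentiableAt ℝ F y)
    (hH : DifferentiableAt ℝ H y) : pd i (fun x => F x + H x) y = pd i F y + pd i H y := by
  simp [pd, fderiv_fun_add hF hH]

theorem pd_sub {F H : Coord n → ℝ} (i : Fin n) (hF : DifferentiableAt ℝ F y)
    (hH : DifferentiableAt ℝ H y) : pd i (fun x => F x - H x) y = pd i F y - pd i H y := by
  simp [pd, fderiv_fun_sub hF hH]

theorem pd_mul {F H : Coord n → ℝ} (i : Fin n) (hF : DifferentiableAt ℝ F y)
    (hH : DifferentiableAt ℝ H y) :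
    pd i (fun x => F x * H x) y = pd i F y * H y + F y * pd i H y := by
  simp only [pd, fderiv_fun_mul hF hH, _root_.add_apply, _root_.smul_apply, smul_eq_mul]
  ring

theorem pd_const_mul {H : Coord n → ℝ} (i : Fin n) (c : ℝ)
    (hH : DifferentiableAt ℝ H y) :
    pd i (fun x => c * H x) y = c * pd i H y := by
  rw [pd_mul i (differentiableAt_const c) hH, pd_const, zero_mul, zero_add]

theorem pd_sum {ι : Type*} (s : Finset ι) {F : ι → Coord n → ℝ} (i : Fin n)
    (hF : ∀ k, DifferentiableAt ℝ (F k) y) :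
    pd i (fun x => ∑ k ∈ s, F k x) y = ∑ k ∈ s, pd i (F k) y := by
  simp [pd, fderiv_fun_sum (fun k _ => hF k)]

/-- A function is smooth on the open set `U`. -/
abbrev SmoothOn (U : Set (Coord n)) (F : Coord n → ℝ) : Prop := ContDiffOn ℝ ∞ F U

theorem SmoothOn.diff {F : Coord n → ℝ} (h : SmoothOn U F) (hU : IsOpen U) (hy : y ∈ U) :
    DifferentiableAt ℝ F y :=
  ((h.contDiffAt (hU.mem_nhds hy)).differentiableAt (by simp))

theorem SmoothOn.pd {F : Coord n → ℝ} (h : SmoothOn U F) (hU : IsOpen U) (i : Fin n) :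
    SmoothOn U (pd i F) :=
  (h.fderiv_of_isOpen hU (m := ∞) (by simp)).clm_apply contDiffOn_const

theorem SmoothOn.sum {ι : Type*} {s : Finset ι} {F : ι → Coord n → ℝ}
    (h : ∀ k, SmoothOn U (F k)) : SmoothOn U (fun x => ∑ k ∈ s, F k x) :=
  ContDiffOn.sum fun k _ => h k

theorem pd_comm {F : Coord n → ℝ} (h : SmoothOn U F) (hU : IsOpen U) (hy : y ∈ U) (i j : Fin n) :
    pd i (pd j F) y = pd j (pd i F) y := by
  have hs : IsSymmSndFDerivAt ℝ F y :=
    (h.contDiffAt (hU.mem_nhds hy)).isSymmSndFDerivAt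
      (by rw [minSmoothness_of_isRCLikeNormedField]; exact WithTop.coe_le_coe.mpr le_top)
  have hd : DifferentiableAt ℝ (fderiv ℝ F) y :=
    ((h.fderiv_of_isOpen hU (m := ∞) (by simp)).contDiffAt (hU.mem_nhds hy)).differentiableAt
      (by simp)
  have key : ∀ a b : Fin n, StaticSpace.pd a (StaticSpace.pd b F) y
      = fderiv ℝ (fderiv ℝ F) y (EuclideanSpace.single a 1) (EuclideanSpace.single b 1) := by
    intro a b
    have : StaticSpace.pd b F = fun x => fderiv ℝ F x (EuclideanSpace.single b 1) := rfl
    rw [StaticSpace.pd, this, fderiv_clm_apply hd (differentiableAt_const _)]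
    simp
  rw [key, key, hs]

/-! ### Matrix fields -/

/-- The entrywise partial derivative of a matrix field. -/
noncomputable def pdM (i : Fin n) (A : Coord n → Matrix (Fin n) (Fin n) ℝ) (y : Coord n) :
    Matrix (Fin n) (Fin n) ℝ :=
  Matrix.of fun a b => pd i (fun x => A x a b) y

/-- A matrix field with smooth entries. -/
def SmoothMOn (U : Set (Coord n)) (A : Coord n → Matrix (Fin n) (Fin n) ℝ) : Prop :=
  ∀ a b, SmoothOn U (fun x => A x a b)

theorem SmoothMOn.pdM {A : Coord n → Matrix (Fin n) (Fin n) ℝ} (h : SmoothMOn U A)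
    (hU : IsOpen U) (i : Fin n) : SmoothMOn U (pdM i A) :=
  fun a b => (h a b).pd hU i

theorem SmoothMOn.mul {A B : Coord n → Matrix (Fin n) (Fin n) ℝ} (hA : SmoothMOn U A)
    (hB : SmoothMOn U B) : SmoothMOn U (fun x => A x * B x) := by
  intro a b
  simp only [Matrix.mul_apply]
  exact SmoothOn.sum fun k => (hA a k).mul (hB k b)

theorem SmoothMOn.add {A B : Coord n → Matrix (Fin n) (Fin n) ℝ} (hA : SmoothMOn U A)
    (hB : SmoothMOn U B) : SmoothMOn U (fun x => A x + B x) :=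
  fun a b => (hA a b).add (hB a b)

theorem SmoothMOn.sub {A B : Coord n → Matrix (Fin n) (Fin n) ℝ} (hA : SmoothMOn U A)
    (hB : SmoothMOn U B) : SmoothMOn U (fun x => A x - B x) :=
  fun a b => (hA a b).sub (hB a b)

theorem SmoothMOn.transpose {A : Coord n → Matrix (Fin n) (Fin n) ℝ} (hA : SmoothMOn U A) :
    SmoothMOn U (fun x => (A x)ᵀ) :=
  fun a b => hA b a

theorem SmoothMOn.det {A : Coord n → Matrix (Fin n) (Fin n) ℝ} (hA : SmoothMOn U A) :
    SmoothOn U (fun x => (A x).det) := by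
  simp only [Matrix.det_apply]
  refine SmoothOn.sum fun σ => ?_
  refine ContDiffOn.const_smul _ ?_
  exact contDiffOn_prod fun i _ => hA _ _

theorem SmoothMOn.adjugate {A : Coord n → Matrix (Fin n) (Fin n) ℝ} (hA : SmoothMOn U A) :
    SmoothMOn U (fun x => (A x).adjugate) := by
  intro a b
  simp only [Matrix.adjugate_apply]
  refine SmoothMOn.det fun i j => ?_
  by_cases h : i = b
  · subst h
    simpa using contDiffOn_const
  · simpa [Matrix.updateRow_apply, h] using hA i j

/-- Cramer's rule: the entries of the inverse are polynomials in the entries of A divided by the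
nonvanishing determinant. -/
theorem SmoothMOn.inv {A : Coord n → Matrix (Fin n) (Fin n) ℝ} (hA : SmoothMOn U A)
    (h : ∀ x ∈ U, IsUnit (A x).det) : SmoothMOn U (fun x => (A x)⁻¹) := by
  intro a b
  have : SmoothOn U (fun x => ((A x).det)⁻¹ * (A x).adjugate a b) :=
    (hA.det.inv fun x hx => (h x hx).ne_zero).mul (hA.adjugate a b)
  refine this.congr fun x _ => ?_
  simp [Matrix.inv_def]

theorem pdM_congr_on {A B : Coord n → Matrix (Fin n) (Fin n) ℝ} (hU : IsOpen U)
    (h : ∀ x ∈ U, A x = B x) (hy : y ∈ U) (i : Fin n) : pdM i A y = pdM i B y := by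
  ext a b
  exact pd_congr_on hU (fun x hx => by rw [h x hx]) hy i

theorem pdM_mul {A B : Coord n → Matrix (Fin n) (Fin n) ℝ} (hA : SmoothMOn U A)
    (hB : SmoothMOn U B) (hU : IsOpen U) (hy : y ∈ U) (i : Fin n) :
    pdM i (fun x => A x * B x) y = pdM i A y * B y + A y * pdM i B y := by
  ext a b
  simp only [pdM, Matrix.mul_apply, Matrix.of_apply, Matrix.add_apply]
  rw [pd_sum _ _ fun k => ((hA a k).diff hU hy).fun_mul ((hB k b).diff hU hy),
    ← Finset.sum_add_distrib]
  exact Finset.sum_congr rfl fun k _ => pd_mul i ((hA a k).diff hU hy) ((hB k b).diff hU hy)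

theorem pdM_add {A B : Coord n → Matrix (Fin n) (Fin n) ℝ} (hA : SmoothMOn U A)
    (hB : SmoothMOn U B) (hU : IsOpen U) (hy : y ∈ U) (i : Fin n) :
    pdM i (fun x => A x + B x) y = pdM i A y + pdM i B y := by
  ext a b
  exact pd_add i ((hA a b).diff hU hy) ((hB a b).diff hU hy)

theorem pdM_sub {A B : Coord n → Matrix (Fin n) (Fin n) ℝ} (hA : SmoothMOn U A)
    (hB : SmoothMOn U B) (hU : IsOpen U) (hy : y ∈ U) (i : Fin n) :
    pdM i (fun x => A x - B x) y = pdM i A y - pdM i B y := by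
  ext a b
  exact pd_sub i ((hA a b).diff hU hy) ((hB a b).diff hU hy)

theorem pdM_transpose (A : Coord n → Matrix (Fin n) (Fin n) ℝ) (i : Fin n) (y : Coord n) :
    pdM i (fun x => (A x)ᵀ) y = (pdM i A y)ᵀ := rfl

theorem pdM_comm {A : Coord n → Matrix (Fin n) (Fin n) ℝ} (hA : SmoothMOn U A)
    (hU : IsOpen U) (hy : y ∈ U) (i j : Fin n) :
    pdM i (pdM j A) y = pdM j (pdM i A) y := by
  ext a b
  exact pd_comm (hA a b) hU hy i j

/-! ### The Levi-Civita connection and its curvature -/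

/-- `G` is a smooth Riemannian metric on the open set `U` of the coordinate space. -/
structure IsMetricOn (U : Set (Coord n)) (G : CoordMetric n) : Prop where
  isOpen : IsOpen U
  smooth : SmoothMOn U G
  posDef : ∀ x ∈ U, (G x).PosDef

namespace IsMetricOn

theorem mono (h : IsMetricOn U G) {V : Set (Coord n)} (hV : IsOpen V) (hVU : V ⊆ U) :
    IsMetricOn V G :=
  ⟨hV, fun a b => (h.smooth a b).mono hVU, fun x hx => h.posDef x (hVU hx)⟩

theorem symm (h : IsMetricOn U G) (hy : y ∈ U) (i j : Fin n) : G y i j = G y j i := by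
  simpa using ((h.posDef y hy).isHermitian.apply i j).symm

theorem transpose_eq (h : IsMetricOn U G) (hy : y ∈ U) : (G y)ᵀ = G y := by
  ext i j
  exact h.symm hy j i

theorem isUnit_det (h : IsMetricOn U G) (hy : y ∈ U) : IsUnit (G y).det :=
  (h.posDef y hy).det_pos.ne'.isUnit

theorem inv_mul (h : IsMetricOn U G) (hy : y ∈ U) : (G y)⁻¹ * G y = 1 :=
  Matrix.nonsing_inv_mul _ (h.isUnit_det hy)

theorem mul_inv (h : IsMetricOn U G) (hy : y ∈ U) : G y * (G y)⁻¹ = 1 :=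
  Matrix.mul_nonsing_inv _ (h.isUnit_det hy)

theorem smooth_inv (h : IsMetricOn U G) : SmoothMOn U (fun x => (G x)⁻¹) :=
  h.smooth.inv fun _ hx => h.isUnit_det hx

theorem smooth_ginv (h : IsMetricOn U G) (i j : Fin n) : SmoothOn U (ginv G i j) :=
  h.smooth_inv i j

theorem ginv_symm (h : IsMetricOn U G) (hy : y ∈ U) (i j : Fin n) :
    ginv G i j y = ginv G j i y := by
  have : ((G y)⁻¹)ᵀ = (G y)⁻¹ := by rw [Matrix.transpose_nonsing_inv, h.transpose_eq hy]
  exact congrFun (congrFun this.symm i) j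

theorem smooth_christoffel (h : IsMetricOn U G) (k i j : Fin n) :
    SmoothOn U (christoffel G k i j) := by
  refine contDiffOn_const.mul (SmoothOn.sum fun l => (h.smooth_ginv k l).mul ?_)
  exact (((h.smooth j l).pd h.isOpen i).add ((h.smooth i l).pd h.isOpen j)).sub
    ((h.smooth i j).pd h.isOpen l)

theorem pd_symm (h : IsMetricOn U G) (hy : y ∈ U) (i j k : Fin n) :
    pd i (fun x => G x j k) y = pd i (fun x => G x k j) y :=
  pd_congr_on h.isOpen (fun _ hx => h.symm hx j k) hy i

theorem christoffel_symm (h : IsMetricOn U G) (hy : y ∈ U) (k i j : Fin n) :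
    christoffel G k i j y = christoffel G k j i y := by
  unfold christoffel
  congr 1
  refine Finset.sum_congr rfl fun l _ => ?_
  rw [h.pd_symm hy l i j]
  ring

theorem lower_christoffel (h : IsMetricOn U G) (hy : y ∈ U) (l i j : Fin n) :
    ∑ m, G y l m * christoffel G m i j y
      = (1 / 2) * (pd i (fun x => G x j l) y + pd j (fun x => G x i l) y
          - pd l (fun x => G x i j) y) := by
  set t : Fin n → ℝ := fun l => pd i (fun x => G x j l) y + pd j (fun x => G x i l) y
          - pd l (fun x => G x i j) y
  have h1 : ∀ m, christoffel G m i j y = (1 / 2) * ((G y)⁻¹ *ᵥ t) m := fun m => rfl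
  have h2 : G y *ᵥ ((G y)⁻¹ *ᵥ t) = t := by
    rw [Matrix.mulVec_mulVec, h.mul_inv hy, Matrix.one_mulVec]
  have h3 := congrFun h2 l
  rw [Matrix.mulVec, dotProduct] at h3
  refine Eq.trans ?_ (congrArg ((1 / 2) * ·) h3)
  simp only [Finset.mul_sum]
  exact Finset.sum_congr rfl fun m _ => by rw [h1]; ring

end IsMetricOn

/-- The connection matrix `(Γ_i)^m_k`. -/
noncomputable def connM (G : CoordMetric n) (i : Fin n) (y : Coord n) :
    Matrix (Fin n) (Fin n) ℝ :=
  Matrix.of fun m k => christoffel G m i k y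

/-- The curvature matrix `R_{ijk}^m`. -/
noncomputable def curvM (G : CoordMetric n) (i j : Fin n) (y : Coord n) :
    Matrix (Fin n) (Fin n) ℝ :=
  pdM j (connM G i) y - pdM i (connM G j) y + (connM G j y * connM G i y
    - connM G i y * connM G j y)

/-- With the curvature as a matrix-valued 2-form, the metric antisymmetry and the second Bianchi
identity become noncommutative polynomial identities in the connection matrices and their
derivatives. -/
theorem riem_eq (G : CoordMetric n) (i j k l : Fin n) (y : Coord n) :
    riem G i j k l y = (G y * curvM G i j y) l k := by
  simp only [riem, Matrix.mul_apply, curvM, Matrix.add_apply, Matrix.sub_apply,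
    Finset.sum_sub_distrib]
  refine Finset.sum_congr rfl fun m _ => ?_
  congr 2
  congr 1 <;> exact Finset.sum_congr rfl fun p _ => mul_comm _ _

namespace IsMetricOn

theorem smooth_connM (h : IsMetricOn U G) (i : Fin n) : SmoothMOn U (connM G i) :=
  fun m k => h.smooth_christoffel m i k

theorem smooth_curvM (h : IsMetricOn U G) (i j : Fin n) : SmoothMOn U (curvM G i j) :=
  (((h.smooth_connM i).pdM h.isOpen j).sub ((h.smooth_connM j).pdM h.isOpen i)).add
    (((h.smooth_connM j).mul (h.smooth_connM i)).sub ((h.smooth_connM i).mul (h.smooth_connM j)))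

/-- The metric is parallel. -/
theorem pdM_metric (h : IsMetricOn U G) (hy : y ∈ U) (i : Fin n) :
    pdM i G y = (connM G i y)ᵀ * G y + G y * connM G i y := by
  ext j k
  simp only [Matrix.add_apply, Matrix.mul_apply, Matrix.transpose_apply, connM, Matrix.of_apply]
  have h1 : ∑ m, christoffel G m i j y * G y m k = ∑ m, G y k m * christoffel G m i j y :=
    Finset.sum_congr rfl fun m _ => by rw [h.symm hy m k, mul_comm]
  rw [h1, h.lower_christoffel hy, h.lower_christoffel hy, h.pd_symm hy k i j, h.pd_symm hy j i k,
    h.pd_symm hy i k j]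
  simp only [pdM, Matrix.of_apply]
  ring

theorem pd_metric (h : IsMetricOn U G) (hy : y ∈ U) (i j k : Fin n) :
    pd i (fun x => G x j k) y
      = ∑ m, (christoffel G m i j y * G y m k + christoffel G m i k y * G y j m) := by
  have := congrFun (congrFun (h.pdM_metric hy i) j) k
  simp only [Matrix.add_apply, Matrix.mul_apply, Matrix.transpose_apply, connM, Matrix.of_apply,
    pdM] at this
  rw [this, ← Finset.sum_add_distrib]
  exact Finset.sum_congr rfl fun m _ => by ring

/-- The inverse metric is parallel. -/
theorem pdM_inv (h : IsMetricOn U G) (hy : y ∈ U) (i : Fin n) :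
    pdM i (fun x => (G x)⁻¹) y
      = -(connM G i y * (G y)⁻¹ + (G y)⁻¹ * (connM G i y)ᵀ) := by
  -- Differentiate G⁻¹G = 1, then multiply by G⁻¹ on the right.
  have h0 : pdM i (fun x => (G x)⁻¹ * G x) y = 0 := by
    rw [pdM_congr_on h.isOpen (B := fun _ => 1) (fun x hx => h.inv_mul hx) hy]
    ext a b
    exact pd_const _ _ _
  rw [pdM_mul h.smooth_inv h.smooth h.isOpen hy, h.pdM_metric hy] at h0
  have h1 : (pdM i (fun x => (G x)⁻¹) y) * (G y * (G y)⁻¹)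
      = - ((G y)⁻¹ * (connM G i y)ᵀ * (G y * (G y)⁻¹)
        + ((G y)⁻¹ * G y) * connM G i y * (G y)⁻¹) := by
    have := congrArg (· * (G y)⁻¹) h0
    simp only [zero_mul, add_mul, mul_add, Matrix.mul_assoc] at this ⊢
    rw [eq_neg_iff_add_eq_zero]
    exact this
  rw [h.mul_inv hy, h.inv_mul hy] at h1
  simp only [mul_one, one_mul] at h1
  rw [h1, add_comm]

theorem pd_ginv (h : IsMetricOn U G) (hy : y ∈ U) (i j k : Fin n) :
    pd i (ginv G j k) y
      = - ∑ m, (christoffel G j i m y * ginv G m k y + christoffel G k i m y * ginv G j m y) := by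
  have := congrFun (congrFun (h.pdM_inv hy i) j) k
  simp only [Matrix.add_apply, Matrix.mul_apply, Matrix.transpose_apply, connM, Matrix.of_apply,
    pdM, Matrix.neg_apply] at this
  rw [show pd i (ginv G j k) y = pd i (fun x => (G x)⁻¹ j k) y from rfl, this,
    ← Finset.sum_add_distrib]
  congr 1
  exact Finset.sum_congr rfl fun m _ => by simp only [ginv]; ring

/-! ### Symmetries of the Riemann tensor and the Bianchi identities. -/

theorem riem_antisymm_left (i j k l : Fin n) :
    riem G i j k l y = - riem G j i k l y := by
  rw [riem_eq, riem_eq, ← Matrix.neg_apply, ← Matrix.mul_neg]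
  have : curvM G i j y = - curvM G j i y := by
    simp only [curvM]
    noncomm_ring
  rw [this]

/-- Differentiate the parallelism of G once more: the commutation of ∂_i and ∂_j on G says exactly
that GΩ is skew, where Ω is the curvature matrix. -/
theorem riem_antisymm_right (h : IsMetricOn U G) (hy : y ∈ U) (i j k l : Fin n) :
    riem G i j k l y = - riem G i j l k y := by
  have key : (G y * curvM G i j y) = - (G y * curvM G i j y)ᵀ := by
    have hc := pdM_comm h.smooth h.isOpen hy i j
    have e : ∀ a b : Fin n, pdM a (pdM b G) y
        = (pdM a (connM G b) y)ᵀ * G y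
          + (connM G b y)ᵀ * ((connM G a y)ᵀ * G y + G y * connM G a y)
          + (((connM G a y)ᵀ * G y + G y * connM G a y) * connM G b y
          + G y * pdM a (connM G b) y) := by
      intro a b
      rw [pdM_congr_on h.isOpen (fun x hx => h.pdM_metric hx b) hy,
        pdM_add ((h.smooth_connM b).transpose.mul h.smooth) (h.smooth.mul (h.smooth_connM b))
          h.isOpen hy, pdM_mul (h.smooth_connM b).transpose h.smooth h.isOpen hy,
        pdM_mul h.smooth (h.smooth_connM b) h.isOpen hy, pdM_transpose, h.pdM_metric hy]
    rw [e, e] at hc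
    rw [Matrix.transpose_mul, h.transpose_eq hy, eq_neg_iff_add_eq_zero]
    simp only [curvM, Matrix.transpose_add, Matrix.transpose_sub, Matrix.transpose_mul]
    rw [← sub_eq_zero] at hc
    rw [← neg_eq_zero, ← hc]
    noncomm_ring
  rw [riem_eq, riem_eq]
  nth_rewrite 1 [key]
  rfl

/-- Only the symmetry of Γ in its lower indices matters: both the derivative and the quadratic terms
cancel in the cyclic sum. -/
theorem riem_bianchi (h : IsMetricOn U G) (hy : y ∈ U) (i j k l : Fin n) :
    riem G i j k l y + riem G j k i l y + riem G k i j l y = 0 := by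
  simp only [riem, ← Finset.sum_add_distrib, ← mul_add]
  refine Finset.sum_eq_zero fun m _ => ?_
  have hp : ∀ a b c : Fin n, pd a (christoffel G m b c) y = pd a (christoffel G m c b) y :=
    fun a b c => pd_congr_on h.isOpen (fun x hx => h.christoffel_symm hx m b c) hy a
  have : ∀ a b c : Fin n, ∑ p, (christoffel G p a c y * christoffel G m b p y
          - christoffel G p b c y * christoffel G m a p y)
      = ∑ p, christoffel G p a c y * christoffel G m b p y
        - ∑ p, christoffel G p b c y * christoffel G m a p y := fun a b c =>
    Finset.sum_sub_distrib _ _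
  have hs : ∀ a b c : Fin n, ∑ p, christoffel G p a c y * christoffel G m b p y
      = ∑ p, christoffel G p c a y * christoffel G m b p y := fun a b c =>
    Finset.sum_congr rfl fun p _ => by rw [h.christoffel_symm hy p a c]
  rw [this, this, this]
  linear_combination G y l m * (hp j i k + hp i k j + hp k j i + hs i j k + hs j k i + hs k i j)

theorem riem_pair_symm (h : IsMetricOn U G) (hy : y ∈ U) (i j k l : Fin n) :
    riem G i j k l y = riem G k l i j y := by
  have b := fun i j k l => h.riem_bianchi hy i j k l
  have a := fun i j k l => h.riem_antisymm_right hy i j k l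
  have c := fun i j k l => riem_antisymm_left (G := G) (y := y) i j k l
  linarith [b i j k l, b j k l i, b k l i j, b l i j k, a i j k l, a k l i j, a j k l i, a l i j k,
    a j l i k, a i k j l, c j k i l, c k i j l, c k l j i, c l j k i, c l i k j, c i k l j,
    c i j l k, c j l i k, a i k l j, a k i j l, a j k i l, a k l j i, a l j k i, a l i k j,
    a j l k i, c l i j k, c j k l i, c j l k i]

/-- The second Bianchi identity. -/
theorem cov4_riem_bianchi (h : IsMetricOn U G) (hy : y ∈ U) (p i j k l : Fin n) :
    cov4 G (riem G) p i j k l y + cov4 G (riem G) i j p k l y + cov4 G (riem G) j p i k l y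
      = 0 := by
  -- Since G is parallel, the connection terms of the last two slots turn ∂_pΩ into the commutator
  -- expression ∂_pΩ + [Γ_p, Ω]; those of the first two slots are left aside.
  have expand : ∀ p i j : Fin n, cov4 G (riem G) p i j k l y
      = (G y * (pdM p (curvM G i j) y + connM G p y * curvM G i j y
          - curvM G i j y * connM G p y)) l k
        - ∑ m, (christoffel G m p i y * riem G m j k l y
          + christoffel G m p j y * riem G i m k l y) := by
    intro p i j
    have e1 : pd p (riem G i j k l) y = pdM p (fun x => G x * curvM G i j x) y l k := by
      simp only [pdM, Matrix.of_apply]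
      congr 1
      ext x
      exact riem_eq G i j k l x
    rw [pdM_mul h.smooth (h.smooth_curvM i j) h.isOpen hy, h.pdM_metric hy] at e1
    have e2 : ∑ m, christoffel G m p k y * riem G i j m l y
        = (G y * curvM G i j y * connM G p y) l k := by
      rw [Matrix.mul_apply]
      exact Finset.sum_congr rfl fun m _ => by rw [riem_eq, mul_comm]; rfl
    have e3 : ∑ m, christoffel G m p l y * riem G i j k m y
        = ((connM G p y)ᵀ * (G y * curvM G i j y)) l k := by
      rw [Matrix.mul_apply]
      exact Finset.sum_congr rfl fun m _ => by rw [riem_eq]; rfl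
    rw [cov4, e1, Finset.sum_add_distrib, Finset.sum_add_distrib, e2, e3]
    have e4 : (G y * (pdM p (curvM G i j) y + connM G p y * curvM G i j y
          - curvM G i j y * connM G p y))
        = (((connM G p y)ᵀ * G y + G y * connM G p y) * curvM G i j y
          + G y * pdM p (curvM G i j) y) - (G y * curvM G i j y * connM G p y)
          - ((connM G p y)ᵀ * (G y * curvM G i j y)) := by
      noncomm_ring
    rw [e4, Matrix.sub_apply, Matrix.sub_apply]
    ring
  have d : ∀ p i j : Fin n, pdM p (curvM G i j) y
      = pdM p (pdM j (connM G i)) y - pdM p (pdM i (connM G j)) y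
        + ((pdM p (connM G j) y * connM G i y + connM G j y * pdM p (connM G i) y)
          - (pdM p (connM G i) y * connM G j y + connM G i y * pdM p (connM G j) y)) := by
    intro p i j
    have hi := h.smooth_connM i
    have hj := h.smooth_connM j
    have hO := h.isOpen
    rw [← pdM_mul hj hi hO hy, ← pdM_mul hi hj hO hy, ← pdM_sub (hj.mul hi) (hi.mul hj) hO hy,
      ← pdM_sub (hi.pdM hO j) (hj.pdM hO i) hO hy,
      ← pdM_add ((hi.pdM hO j).sub (hj.pdM hO i)) ((hj.mul hi).sub (hi.mul hj)) hO hy]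
    rfl
  -- The Bianchi identity of the matrix-valued curvature form, which holds for any connection.
  have hM : (pdM p (curvM G i j) y + connM G p y * curvM G i j y - curvM G i j y * connM G p y)
      + (pdM i (curvM G j p) y + connM G i y * curvM G j p y - curvM G j p y * connM G i y)
      + (pdM j (curvM G p i) y + connM G j y * curvM G p i y - curvM G p i y * connM G j y)
      = 0 := by
    rw [d, d, d, pdM_comm (h.smooth_connM i) h.isOpen hy p j,
      pdM_comm (h.smooth_connM j) h.isOpen hy p i,
      pdM_comm (h.smooth_connM p) h.isOpen hy i j]
    simp only [curvM]
    noncomm_ring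
  have split : ∀ X Y Z : Matrix (Fin n) (Fin n) ℝ, X + Y + Z = 0 →
      (G y * X) l k + (G y * Y) l k + (G y * Z) l k = 0 := by
    intro X Y Z hXYZ
    rw [← Matrix.add_apply, ← Matrix.add_apply, ← mul_add, ← mul_add, hXYZ, mul_zero,
      Matrix.zero_apply]
  have hM' := split _ _ _ hM
  rw [expand, expand, expand]
  -- By torsion-freeness the corrections in the two form slots are differences that telescope over
  -- the cyclic sum.
  have ht : ∀ p i j : Fin n, ∑ m, (christoffel G m p i y * riem G m j k l y
          + christoffel G m p j y * riem G i m k l y)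
      = ∑ m, christoffel G m p i y * riem G m j k l y
        - ∑ m, christoffel G m j p y * riem G m i k l y := by
    intro p i j
    rw [← Finset.sum_sub_distrib]
    exact Finset.sum_congr rfl fun m _ => by
      rw [riem_antisymm_left i m, h.christoffel_symm hy m p j]; ring
  rw [ht, ht, ht]
  linarith

/-! ### Smoothness of the curvature tensors -/

theorem smooth_riem (h : IsMetricOn U G) (i j k l : Fin n) : SmoothOn U (riem G i j k l) :=
  ((h.smooth.mul (h.smooth_curvM i j)) l k).congr fun x _ => riem_eq G i j k l x

theorem smooth_ric (h : IsMetricOn U G) (j l : Fin n) : SmoothOn U (ric G j l) :=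
  SmoothOn.sum fun i => SmoothOn.sum fun k => (h.smooth_ginv i k).mul (h.smooth_riem i j k l)

theorem smooth_scal (h : IsMetricOn U G) : SmoothOn U (scal G) :=
  SmoothOn.sum fun i => SmoothOn.sum fun k => (h.smooth_ginv i k).mul (h.smooth_ric i k)

theorem smooth_tracelessRic (h : IsMetricOn U G) (i j : Fin n) :
    SmoothOn U (tracelessRic G i j) :=
  (h.smooth_ric i j).sub ((h.smooth_scal.div_const _).mul (h.smooth i j))

theorem smooth_weyl (h : IsMetricOn U G) (i j k l : Fin n) : SmoothOn U (weyl G i j k l) := by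
  have hz := h.smooth_tracelessRic
  have hG := h.smooth
  refine ((h.smooth_riem i j k l).sub ((h.smooth_scal.div_const _).mul
    (((hG i k).mul (hG j l)).sub ((hG i l).mul (hG j k))))).sub (contDiffOn_const.mul ?_)
  exact ((((hz i k).mul (hG j l)).add ((hz j l).mul (hG i k))).sub
    ((hz i l).mul (hG j k))).sub ((hz j k).mul (hG i l))

theorem smooth_weylRic (h : IsMetricOn U G) (i j : Fin n) : SmoothOn U (weylRic G i j) :=
  SmoothOn.sum fun k => SmoothOn.sum fun l => SmoothOn.sum fun p => SmoothOn.sum fun q =>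
    (((h.smooth_ginv k p).mul (h.smooth_ginv l q)).mul (h.smooth_weyl i k j l)).mul
      (h.smooth_ric p q)

theorem smooth_cov2 (h : IsMetricOn U G) {A : Fin n → Fin n → Coord n → ℝ}
    (hA : ∀ j k, SmoothOn U (A j k)) (i j k : Fin n) : SmoothOn U (cov2 G A i j k) :=
  ((hA j k).pd h.isOpen i).sub (SmoothOn.sum fun m =>
    ((h.smooth_christoffel m i j).mul (hA m k)).add ((h.smooth_christoffel m i k).mul (hA j m)))

theorem smooth_cotton (h : IsMetricOn U G) (i j k : Fin n) : SmoothOn U (cotton G i j k) :=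
  ((h.smooth_cov2 h.smooth_ric i j k).sub (h.smooth_cov2 h.smooth_ric j i k)).sub
    (contDiffOn_const.mul (((h.smooth_scal.pd h.isOpen i).mul (h.smooth j k)).sub
      ((h.smooth_scal.pd h.isOpen j).mul (h.smooth i k))))

/-! ### Contractions -/

theorem sum_ginv_mul_metric (h : IsMetricOn U G) (hy : y ∈ U) (i j : Fin n) :
    ∑ k, ginv G i k y * G y k j = if i = j then 1 else 0 := by
  have := congrFun (congrFun (h.inv_mul hy) i) j
  rw [Matrix.mul_apply, Matrix.one_apply] at this
  exact this

theorem sum_ginv_mul_metric' (h : IsMetricOn U G) (hy : y ∈ U) (i j : Fin n) :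
    ∑ k, ginv G i k y * G y j k = if i = j then 1 else 0 := by
  rw [← h.sum_ginv_mul_metric hy i j]
  exact Finset.sum_congr rfl fun k _ => by rw [h.symm hy j k]

theorem contract_metric (h : IsMetricOn U G) (hy : y ∈ U) (X : Fin n → ℝ) (j : Fin n) :
    ∑ p, ∑ l, ginv G p l y * (X p * G y j l) = X j := by
  have : ∀ p, ∑ l, ginv G p l y * (X p * G y j l) = X p * if p = j then 1 else 0 := by
    intro p
    rw [← h.sum_ginv_mul_metric' hy p j, Finset.mul_sum]
    exact Finset.sum_congr rfl fun l _ => by ring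
  simp [this]

theorem trace_metric (h : IsMetricOn U G) (hy : y ∈ U) :
    ∑ p, ∑ l, ginv G p l y * G y p l = n := by
  simp [h.sum_ginv_mul_metric' hy]

theorem contract_swap (h : IsMetricOn U G) (hy : y ∈ U) (A : Fin n → Fin n → ℝ) :
    ∑ p, ∑ l, ginv G p l y * A l p = ∑ p, ∑ l, ginv G p l y * A p l := by
  rw [Finset.sum_comm]
  exact Finset.sum_congr rfl fun l _ => Finset.sum_congr rfl fun p _ => by rw [h.ginv_symm hy]

/-- Covariant differentiation commutes with contraction. -/
theorem pd_contract (h : IsMetricOn U G) (hy : y ∈ U) {A : Fin n → Fin n → Coord n → ℝ}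
    (hA : ∀ j k, SmoothOn U (A j k)) (p : Fin n) :
    pd p (fun x => ∑ k, ∑ l, ginv G k l x * A k l x) y
      = ∑ k, ∑ l, ginv G k l y * cov2 G A p k l y := by
  have hg := fun k l => (h.smooth_ginv k l).diff h.isOpen hy
  have hd := fun k l => (hA k l).diff h.isOpen hy
  rw [pd_sum _ _ fun k => DifferentiableAt.fun_sum fun l _ => (hg k l).fun_mul (hd k l)]
  have e1 : ∀ k, pd p (fun x => ∑ l, ginv G k l x * A k l x) y
      = ∑ l, (pd p (ginv G k l) y * A k l y + ginv G k l y * pd p (A k l) y) := by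
    intro k
    rw [pd_sum _ _ fun l => (hg k l).fun_mul (hd k l)]
    exact Finset.sum_congr rfl fun l _ => pd_mul p (hg k l) (hd k l)
  have e2 : ∑ k, ∑ l, ∑ m, christoffel G k p m y * ginv G m l y * A k l y
      = ∑ k, ∑ l, ∑ m, ginv G k l y * (christoffel G m p k y * A m l y) := by
    rw [Finset.sum_comm]
    conv_rhs => rw [Finset.sum_comm]
    refine Finset.sum_congr rfl fun l _ => ?_
    rw [Finset.sum_comm]
    exact Finset.sum_congr rfl fun m _ => Finset.sum_congr rfl fun k _ => by ring
  have e3 : ∑ k, ∑ l, ∑ m, christoffel G l p m y * ginv G k m y * A k l y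
      = ∑ k, ∑ l, ∑ m, ginv G k l y * (christoffel G m p l y * A k m y) := by
    refine Finset.sum_congr rfl fun k _ => ?_
    rw [Finset.sum_comm]
    exact Finset.sum_congr rfl fun m _ => Finset.sum_congr rfl fun l _ => by ring
  have e4 : ∀ k l, ginv G k l y * cov2 G A p k l y = ginv G k l y * pd p (A k l) y
      - (∑ m, ginv G k l y * (christoffel G m p k y * A m l y)
        + ∑ m, ginv G k l y * (christoffel G m p l y * A k m y)) := by
    intro k l
    rw [cov2, mul_sub, Finset.mul_sum, ← Finset.sum_add_distrib]
    simp only [mul_add]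
  have e5 : ∀ k l, pd p (ginv G k l) y * A k l y + ginv G k l y * pd p (A k l) y
      = ginv G k l y * pd p (A k l) y
        - (∑ m, christoffel G k p m y * ginv G m l y * A k l y
          + ∑ m, christoffel G l p m y * ginv G k m y * A k l y) := by
    intro k l
    rw [h.pd_ginv hy, ← Finset.sum_add_distrib]
    simp only [← add_mul, ← Finset.sum_mul]
    ring
  simp only [e1, e4, e5, Finset.sum_sub_distrib, Finset.sum_add_distrib, e2, e3]

theorem contract_cov2_ric (h : IsMetricOn U G) (hy : y ∈ U) (p : Fin n) :
    ∑ k, ∑ l, ginv G k l y * cov2 G (ric G) p k l y = pd p (scal G) y :=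
  (h.pd_contract hy h.smooth_ric p).symm

theorem contract_cov4_riem (h : IsMetricOn U G) (hy : y ∈ U) (p j l : Fin n) :
    ∑ i, ∑ k, ginv G i k y * cov4 G (riem G) p i j k l y = cov2 G (ric G) p j l y := by
  have e : ∀ i k, ginv G i k y * cov4 G (riem G) p i j k l y
      = ginv G i k y * cov2 G (fun i k => riem G i j k l) p i k y
        - (∑ m, christoffel G m p j y * (ginv G i k y * riem G i m k l y)
          + ∑ m, christoffel G m p l y * (ginv G i k y * riem G i j k m y)) := by
    intro i k
    simp only [cov4, cov2, Finset.sum_add_distrib, mul_sub, mul_add, Finset.mul_sum]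
    have c1 : ∀ m, christoffel G m p j y * (ginv G i k y * riem G i m k l y)
      = ginv G i k y * (christoffel G m p j y * riem G i m k l y) := fun m => by ring
    have c2 : ∀ m, christoffel G m p l y * (ginv G i k y * riem G i j k m y)
      = ginv G i k y * (christoffel G m p l y * riem G i j k m y) := fun m => by ring
    simp only [c1, c2]
    ring
  have s1 : ∀ B : Fin n → Fin n → Fin n → ℝ, ∀ c : Fin n → ℝ,
      ∑ i, ∑ k, ∑ m, c m * B i k m = ∑ m, c m * ∑ i, ∑ k, B i k m := by
    intro B c
    simp only [Finset.mul_sum]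
    exact (Finset.sum_congr rfl fun i _ => Finset.sum_comm).trans Finset.sum_comm
  simp only [e, Finset.sum_sub_distrib, Finset.sum_add_distrib,
    ← h.pd_contract hy (fun i k => h.smooth_riem i j k l)]
  rw [s1 (fun i k m => ginv G i k y * riem G i m k l y),
    s1 (fun i k m => ginv G i k y * riem G i j k m y), cov2, Finset.sum_add_distrib]
  rfl

theorem pd_neg_on {F H : Coord n → ℝ} (hU : IsOpen U) (hH : SmoothOn U H)
    (hF : ∀ x ∈ U, F x = - H x) (hy : y ∈ U) (i : Fin n) : pd i F y = - pd i H y := by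
  rw [pd_congr_on hU (H := fun x => (-1) * H x) (fun x hx => by rw [hF x hx]; ring) hy,
    pd_const_mul i _ (hH.diff hU hy)]
  ring

theorem cov4_riem_antisymm_left (h : IsMetricOn U G) (hy : y ∈ U) (p i j k l : Fin n) :
    cov4 G (riem G) p i j k l y = - cov4 G (riem G) p j i k l y := by
  have hs : ∑ m, (christoffel G m p i y * riem G m j k l y
        + christoffel G m p j y * riem G i m k l y + christoffel G m p k y * riem G i j m l y
        + christoffel G m p l y * riem G i j k m y)
      = - ∑ m, (christoffel G m p j y * riem G m i k l y
        + christoffel G m p i y * riem G j m k l y + christoffel G m p k y * riem G j i m l y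
        + christoffel G m p l y * riem G j i k m y) := by
    rw [← Finset.sum_neg_distrib]
    refine Finset.sum_congr rfl fun m _ => ?_
    have a := fun i j k l => riem_antisymm_left (G := G) (y := y) i j k l
    linear_combination christoffel G m p i y * a m j k l + christoffel G m p j y * a i m k l
      + christoffel G m p k y * a i j m l + christoffel G m p l y * a i j k m
  rw [cov4, cov4, hs,
    pd_neg_on h.isOpen (h.smooth_riem j i k l) (fun x _ => riem_antisymm_left i j k l) hy]
  ring

theorem cov4_riem_antisymm_right (h : IsMetricOn U G) (hy : y ∈ U) (p i j k l : Fin n) :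
    cov4 G (riem G) p i j k l y = - cov4 G (riem G) p i j l k y := by
  have hs : ∑ m, (christoffel G m p i y * riem G m j k l y
        + christoffel G m p j y * riem G i m k l y + christoffel G m p k y * riem G i j m l y
        + christoffel G m p l y * riem G i j k m y)
      = - ∑ m, (christoffel G m p i y * riem G m j l k y
        + christoffel G m p j y * riem G i m l k y + christoffel G m p l y * riem G i j m k y
        + christoffel G m p k y * riem G i j l m y) := by
    rw [← Finset.sum_neg_distrib]
    refine Finset.sum_congr rfl fun m _ => ?_
    have a := fun i j k l => h.riem_antisymm_right hy i j k l
    linear_combination christoffel G m p i y * a m j k l + christoffel G m p j y * a i m k l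
      + christoffel G m p k y * a i j m l + christoffel G m p l y * a i j k m
  rw [cov4, cov4, hs, pd_neg_on h.isOpen (h.smooth_riem i j l k)
    (fun x hx => h.riem_antisymm_right hx i j k l) hy]
  ring

theorem ric_symm (h : IsMetricOn U G) (hy : y ∈ U) (j l : Fin n) : ric G j l y = ric G l j y := by
  rw [ric, ric, ← h.contract_swap hy]
  simp only [fun i k => h.riem_pair_symm hy i j k l]

theorem contract_riem (h : IsMetricOn U G) (hy : y ∈ U) (i k : Fin n) :
    ∑ j, ∑ l, ginv G j l y * riem G i j k l y = ric G i k y :=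
  Finset.sum_congr rfl fun j _ => Finset.sum_congr rfl fun l _ => by
    rw [riem_antisymm_left, h.riem_antisymm_right hy, neg_neg]

theorem cov2_ric_symm (h : IsMetricOn U G) (hy : y ∈ U) (i j k : Fin n) :
    cov2 G (ric G) i j k y = cov2 G (ric G) i k j y := by
  rw [cov2, cov2, pd_congr_on h.isOpen (fun x hx => h.ric_symm hx j k) hy]
  congr 1
  refine Finset.sum_congr rfl fun m _ => ?_
  rw [h.ric_symm hy m k, h.ric_symm hy j m, add_comm]

/-- The trace over p and l of the second Bianchi identity in p, i, j; antisymmetry brings the two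
other terms to Ricci contractions. -/
theorem div_riem (h : IsMetricOn U G) (hy : y ∈ U) (i j k : Fin n) :
    ∑ p, ∑ l, ginv G p l y * cov4 G (riem G) p i j k l y
      = cov2 G (ric G) j i k y - cov2 G (ric G) i j k y := by
  rw [← h.contract_cov4_riem hy j i k, ← h.contract_cov4_riem hy i j k,
    ← Finset.sum_sub_distrib]
  refine Finset.sum_congr rfl fun p _ => ?_
  rw [← Finset.sum_sub_distrib]
  refine Finset.sum_congr rfl fun l _ => ?_
  rw [h.cov4_riem_antisymm_right hy j p i l k, h.cov4_riem_antisymm_right hy i p j l k,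
    h.cov4_riem_antisymm_left hy i p j k l]
  linear_combination ginv G p l y * h.cov4_riem_bianchi hy p i j k l

/-- The contracted second Bianchi identity. -/
theorem div_ric (h : IsMetricOn U G) (hy : y ∈ U) (i : Fin n) :
    ∑ p, ∑ l, ginv G p l y * cov2 G (ric G) p l i y = 1 / 2 * pd i (scal G) y := by
  -- One double trace of DR is evaluated in both orders: divergence first gives div r - ds, Ricci
  -- contraction first gives -div r.
  have e1 : ∑ j, ∑ k, ginv G j k y * ∑ p, ∑ l, ginv G p l y * cov4 G (riem G) p i j k l y
      = ∑ p, ∑ l, ginv G p l y * cov2 G (ric G) p l i y - pd i (scal G) y := by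
    simp only [h.div_riem hy, mul_sub, Finset.sum_sub_distrib, h.contract_cov2_ric hy]
    simp only [h.cov2_ric_symm hy _ i]
  have e2 : ∑ j, ∑ k, ginv G j k y * ∑ p, ∑ l, ginv G p l y * cov4 G (riem G) p i j k l y
      = - ∑ p, ∑ l, ginv G p l y * cov2 G (ric G) p l i y := by
    have s : ∀ B : Fin n → Fin n → Fin n → Fin n → ℝ, ∑ j, ∑ k, ∑ p, ∑ l, B j k p l
        = ∑ p, ∑ l, ∑ j, ∑ k, B j k p l := by
      intro B
      have := Finset.sum_comm (s := Finset.univ) (t := Finset.univ)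
        (f := fun a b : Fin n × Fin n => B a.1 a.2 b.1 b.2)
      simpa only [Fintype.sum_prod_type] using this
    simp only [Finset.mul_sum]
    rw [s]
    simp only [← Finset.sum_neg_distrib]
    refine Finset.sum_congr rfl fun p _ => Finset.sum_congr rfl fun l _ => ?_
    rw [h.cov2_ric_symm hy, ← h.contract_cov4_riem hy p i l, Finset.mul_sum,
      ← Finset.sum_neg_distrib]
    refine Finset.sum_congr rfl fun j _ => ?_
    rw [Finset.mul_sum, ← Finset.sum_neg_distrib]
    refine Finset.sum_congr rfl fun k _ => ?_
    rw [h.cov4_riem_antisymm_left hy p i j k l]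
    ring
  linarith

/-! ### Leibniz rules -/

theorem cov2_congr_on {A B : Fin n → Fin n → Coord n → ℝ} (hU : IsOpen U)
    (hAB : ∀ j k, ∀ x ∈ U, A j k x = B j k x) (hy : y ∈ U) (i j k : Fin n) :
    cov2 G A i j k y = cov2 G B i j k y := by
  rw [cov2, cov2, pd_congr_on hU (hAB j k) hy]
  simp only [fun j k => hAB j k y hy]

theorem cov2_add {A B : Fin n → Fin n → Coord n → ℝ}
    (hA : ∀ j k, DifferentiableAt ℝ (A j k) y) (hB : ∀ j k, DifferentiableAt ℝ (B j k) y)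
    (i j k : Fin n) :
    cov2 G (fun j k x => A j k x + B j k x) i j k y = cov2 G A i j k y + cov2 G B i j k y := by
  simp only [cov2, pd_add i (hA j k) (hB j k), mul_add, Finset.sum_add_distrib]
  ring

theorem cov2_smul {φ : Coord n → ℝ} {A : Fin n → Fin n → Coord n → ℝ}
    (hφ : DifferentiableAt ℝ φ y) (hA : ∀ j k, DifferentiableAt ℝ (A j k) y) (i j k : Fin n) :
    cov2 G (fun j k x => φ x * A j k x) i j k y
      = pd i φ y * A j k y + φ y * cov2 G A i j k y := by
  have : ∑ m, (christoffel G m i j y * (φ y * A m k y) + christoffel G m i k y * (φ y * A j m y))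
      = φ y * ∑ m, (christoffel G m i j y * A m k y + christoffel G m i k y * A j m y) := by
    rw [Finset.mul_sum]
    exact Finset.sum_congr rfl fun m _ => by ring
  rw [cov2, cov2, pd_mul i hφ (hA j k), this]
  ring

theorem cov2_metric (h : IsMetricOn U G) (hy : y ∈ U) (i j k : Fin n) :
    cov2 G (fun j k x => G x j k) i j k y = 0 := by
  rw [cov2, h.pd_metric hy, sub_self]

theorem cov2_smul_metric (h : IsMetricOn U G) (hy : y ∈ U) {φ : Coord n → ℝ}
    (hφ : DifferentiableAt ℝ φ y) (i j k : Fin n) :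
    cov2 G (fun j k x => φ x * G x j k) i j k y = pd i φ y * G y j k := by
  rw [cov2_smul hφ fun j k => (h.smooth j k).diff h.isOpen hy, h.cov2_metric hy, mul_zero,
    add_zero]

theorem cov2_mul_self {φ : Fin n → Coord n → ℝ}
    (hφ : ∀ j, DifferentiableAt ℝ (φ j) y) (i j k : Fin n) :
    cov2 G (fun j k x => φ j x * φ k x) i j k y
      = cov1 G φ i j y * φ k y + φ j y * cov1 G φ i k y := by
  simp only [cov2, cov1, pd_mul i (hφ j) (hφ k), Finset.sum_add_distrib, sub_mul, mul_sub,
    Finset.sum_mul, Finset.mul_sum]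
  have c : ∀ m, φ j y * (christoffel G m i k y * φ m y)
    = christoffel G m i k y * (φ j y * φ m y) := fun m => by ring
  simp only [c, mul_assoc]
  ring

/-- The covariant derivative of a Kulkarni-Nomizu product with the metric. -/
theorem cov4_sub_kulkarniNomizu (h : IsMetricOn U G) (hy : y ∈ U)
    {Q : Fin n → Fin n → Fin n → Fin n → Coord n → ℝ} (hQ : ∀ i j k l, SmoothOn U (Q i j k l))
    {A : Fin n → Fin n → Coord n → ℝ} (hA : ∀ i j, SmoothOn U (A i j)) (p i j k l : Fin n) :
    cov4 G (fun i j k l x => Q i j k l x - (A i k x * G x j l + A j l x * G x i k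
        - A i l x * G x j k - A j k x * G x i l)) p i j k l y
      = cov4 G Q p i j k l y
        - (cov2 G A p i k y * G y j l + cov2 G A p j l y * G y i k
          - cov2 G A p i l y * G y j k - cov2 G A p j k y * G y i l) := by
  have dG := fun i j => (h.smooth i j).diff h.isOpen hy
  have dA := fun i j => (hA i j).diff h.isOpen hy
  have dAG := fun a b c d => (dA a b).fun_mul (dG c d)
  have e := (pd_sub p ((hQ i j k l).diff h.isOpen hy)
    ((((dAG i k j l).fun_add (dAG j l i k)).fun_sub (dAG i l j k)).fun_sub (dAG j k i l)))
  rw [pd_sub p (((dAG i k j l).fun_add (dAG j l i k)).fun_sub (dAG i l j k)) (dAG j k i l),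
    pd_sub p ((dAG i k j l).fun_add (dAG j l i k)) (dAG i l j k),
    pd_add p (dAG i k j l) (dAG j l i k), pd_mul p (dA _ _) (dG _ _), pd_mul p (dA _ _) (dG _ _),
    pd_mul p (dA _ _) (dG _ _), pd_mul p (dA _ _) (dG _ _), h.pd_metric hy, h.pd_metric hy,
    h.pd_metric hy, h.pd_metric hy] at e
  simp only [cov4, cov2]
  rw [e]
  simp only [sub_mul, Finset.sum_mul, Finset.mul_sum]
  rw [← sub_eq_zero]
  -- Gathers all connection terms under a single sum over m, so that the claim reduces to a
  -- polynomial identity for each m.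
  have z : ∀ (a b c d q : ℝ) (S1 S2 S3 S4 S5 S6 S7 S8 S9 S10 : Fin n → ℝ),
      (∀ m, S1 m + S2 m - S3 m - S4 m + S9 m - S10 m + S5 m + S6 m - S7 m - S8 m = 0) →
      (q - (a + ∑ m, S1 m + (b + ∑ m, S2 m) - (c + ∑ m, S3 m) - (d + ∑ m, S4 m)) - ∑ m, S9 m)
       - (q - ∑ m, S10 m - ((a - ∑ m, S5 m) + (b - ∑ m, S6 m) - (c - ∑ m, S7 m)
          - (d - ∑ m, S8 m))) = 0 := by
    intro a b c d q S1 S2 S3 S4 S5 S6 S7 S8 S9 S10 hm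
    have := Finset.sum_eq_zero (s := Finset.univ) fun m _ => hm m
    simp only [Finset.sum_add_distrib, Finset.sum_sub_distrib] at this
    linarith
  exact z _ _ _ _ _ _ _ _ _ _ _ _ _ _ _ fun m => by ring

end IsMetricOn

/-! ### The Weyl and Bach tensors -/

/-- The Schouten tensor, normalized so that `R = A ∧ g + W`. -/
noncomputable def schouten (G : CoordMetric n) (i j : Fin n) (y : Coord n) : ℝ :=
  1 / ((n : ℝ) - 2) * ric G i j y
    + (1 / 2 * (1 / ((n : ℝ) * ((n : ℝ) - 1))) - 1 / (n : ℝ) * (1 / ((n : ℝ) - 2)))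
      * scal G y * G y i j

/-- The factor 1/2 in the Schouten coefficient appears because g ∧ g counts each term of g_ik g_jl -
g_il g_jk twice. A single Kulkarni-Nomizu factor lets one Leibniz rule compute DW. -/
theorem weyl_eq (G : CoordMetric n) (i j k l : Fin n) (y : Coord n) :
    weyl G i j k l y = riem G i j k l y
      - (schouten G i k y * G y j l + schouten G j l y * G y i k
        - schouten G i l y * G y j k - schouten G j k y * G y i l) := by
  simp only [weyl, schouten, tracelessRic]
  ring

namespace IsMetricOn

theorem smooth_schouten (h : IsMetricOn U G) (i j : Fin n) : SmoothOn U (schouten G i j) :=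
  (contDiffOn_const.mul (h.smooth_ric i j)).add
    ((contDiffOn_const.mul h.smooth_scal).mul (h.smooth i j))

theorem tracelessRic_symm (h : IsMetricOn U G) (hy : y ∈ U) (i j : Fin n) :
    tracelessRic G i j y = tracelessRic G j i y := by
  rw [tracelessRic, tracelessRic, h.ric_symm hy, h.symm hy]

theorem weyl_antisymm_right (h : IsMetricOn U G) (hy : y ∈ U) (i j k l : Fin n) :
    weyl G i j k l y = - weyl G i j l k y := by
  simp only [weyl, h.riem_antisymm_right hy i j k l]
  ring

theorem contract_metric_left (h : IsMetricOn U G) (hy : y ∈ U) (X : Fin n → ℝ) (j : Fin n) :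
    ∑ p, ∑ l, ginv G p l y * (X l * G y p j) = X j := by
  rw [h.contract_swap hy (fun p l => X p * G y l j)]
  simp only [fun l => h.symm hy l j]
  exact h.contract_metric hy X j

theorem trace_tracelessRic (h : IsMetricOn U G) (hy : y ∈ U) (hn : (n : ℝ) ≠ 0) :
    ∑ k, ∑ l, ginv G k l y * tracelessRic G k l y = 0 := by
  have : ∑ k, ∑ l, ginv G k l y * tracelessRic G k l y
      = scal G y - scal G y / n * ∑ k, ∑ l, ginv G k l y * G y k l := by
    simp only [tracelessRic, scal, mul_sub, Finset.sum_sub_distrib, Finset.mul_sum]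
    congr 1
    exact Finset.sum_congr rfl fun k _ => Finset.sum_congr rfl fun l _ => by ring
  rw [this, h.trace_metric hy]
  field_simp
  ring

/-- The coefficients of the curvature decomposition are those for which the s and z parts carry the
whole Ricci trace. -/
theorem contract_weyl (h : IsMetricOn U G) (hy : y ∈ U) (hn : 3 ≤ n) (i j : Fin n) :
    ∑ k, ∑ l, ginv G k l y * weyl G i k j l y = 0 := by
  have hn' : (3 : ℝ) ≤ n := by exact_mod_cast hn
  have n0 : (n : ℝ) ≠ 0 := by linarith
  have n1 : (n : ℝ) - 1 ≠ 0 := by linarith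
  have n2 : (n : ℝ) - 2 ≠ 0 := by linarith
  have e : ∀ k l, ginv G k l y * weyl G i k j l y
      = ginv G k l y * riem G i k j l y
        - scal G y / ((n : ℝ) * ((n : ℝ) - 1)) * (G y i j * (ginv G k l y * G y k l)
          - ginv G k l y * (G y i l * G y k j))
        - 1 / ((n : ℝ) - 2) * (tracelessRic G i j y * (ginv G k l y * G y k l)
          + G y i j * (ginv G k l y * tracelessRic G k l y)
          - ginv G k l y * (tracelessRic G i l y * G y k j)
          - ginv G k l y * (tracelessRic G k j y * G y i l)) := by
    intro k l
    simp only [weyl]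
    ring
  simp only [e, Finset.sum_sub_distrib, Finset.sum_add_distrib, ← Finset.mul_sum,
    h.contract_riem hy, h.trace_metric hy, h.trace_tracelessRic hy n0,
    h.contract_metric_left hy (fun l => G y i l),
    h.contract_metric_left hy (fun l => tracelessRic G i l y),
    h.contract_metric hy (fun k => tracelessRic G k j y)]
  simp only [tracelessRic]
  field_simp
  ring

/-- By Bianchi, the divergences of R and of the Schouten part are combinations of the
antisymmetrized Dr and of ds. When s is constant, the former is C, so everything vanishes. -/
theorem divWeyl_eq_zero (h : IsMetricOn U G) (hs : ∀ x ∈ U, ∀ i, pd i (scal G) x = 0)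
    (hC : ∀ x ∈ U, ∀ i j k, cotton G i j k x = 0) (hy : y ∈ U) (i j k : Fin n) :
    divWeyl G i j k y = 0 := by
  have hric : ∀ i j k, cov2 G (ric G) i j k y = cov2 G (ric G) j i k y := by
    intro i j k
    have := hC y hy i j k
    rw [cotton, hs y hy, hs y hy] at this
    linarith
  have hsch : ∀ i j k, cov2 G (schouten G) i j k y
      = 1 / ((n : ℝ) - 2) * cov2 G (ric G) i j k y := by
    intro i j k
    have dr := fun i j => (h.smooth_ric i j).diff h.isOpen hy
    have ds := h.smooth_scal.diff h.isOpen hy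
    have dG := fun i j => (h.smooth i j).diff h.isOpen hy
    have dk := ds.const_mul
      (1 / 2 * (1 / ((n : ℝ) * ((n : ℝ) - 1))) - 1 / (n : ℝ) * (1 / ((n : ℝ) - 2)))
    have e : schouten G = fun i j x => 1 / ((n : ℝ) - 2) * ric G i j x
      + (1 / 2 * (1 / ((n : ℝ) * ((n : ℝ) - 1))) - 1 / (n : ℝ) * (1 / ((n : ℝ) - 2))) * scal G x
        * G x i j := rfl
    rw [e, cov2_add (fun i j => (dr i j).const_mul _) (fun i j => dk.fun_mul (dG i j)),
      cov2_smul (differentiableAt_const _) dr, h.cov2_smul_metric hy dk, pd_const,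
      pd_const_mul _ _ ds, hs y hy]
    ring
  have e0 : weyl G = fun i j k l x => riem G i j k l x
      - (schouten G i k x * G x j l + schouten G j l x * G x i k
        - schouten G i l x * G x j k - schouten G j k x * G x i l) := by
    funext i j k l x
    exact weyl_eq G i j k l x
  have e1 : ∀ p l, ginv G p l y * cov4 G (weyl G) p i j k l y
      = ginv G p l y * cov4 G (riem G) p i j k l y
        - 1 / ((n : ℝ) - 2) * (ginv G p l y * (cov2 G (ric G) p i k y * G y j l)
          + G y i k * (ginv G p l y * cov2 G (ric G) p l j y)
          - G y j k * (ginv G p l y * cov2 G (ric G) p l i y)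
          - ginv G p l y * (cov2 G (ric G) p j k y * G y i l)) := by
    intro p l
    rw [e0, h.cov4_sub_kulkarniNomizu hy h.smooth_riem h.smooth_schouten]
    simp only [hsch, h.cov2_ric_symm hy p l]
    ring
  simp only [divWeyl, e1, Finset.sum_sub_distrib, Finset.sum_add_distrib, ← Finset.mul_sum,
    h.div_riem hy, h.div_ric hy, hs y hy, h.contract_metric hy (fun p => cov2 G (ric G) p i k y),
    h.contract_metric hy (fun p => cov2 G (ric G) p j k y), hric i j k]
  ring

theorem cov3_eq_zero {A : Fin n → Fin n → Fin n → Coord n → ℝ} (hU : IsOpen U)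
    (hA : ∀ x ∈ U, ∀ i j k, A i j k x = 0) (hy : y ∈ U) (p i j k : Fin n) :
    cov3 G A p i j k y = 0 := by
  rw [cov3, pd_eq_zero_of_on hU (fun x hx => hA x hx i j k) hy]
  simp [hA y hy]

/-- The derivative part of B, in dimension three as in higher ones, differentiates a tensor (C or
div W) that vanishes on an open set. -/
theorem bach_eq (h : IsMetricOn U G) (hs : ∀ x ∈ U, ∀ i, pd i (scal G) x = 0)
    (hC : ∀ x ∈ U, ∀ i j k, cotton G i j k x = 0) (hy : y ∈ U) (i j : Fin n) :
    bach G i j y = 1 / ((n : ℝ) - 2) * weylRic G i j y := by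
  have h1 : divCotton G i j y = 0 := by
    simp [divCotton, cov3_eq_zero h.isOpen hC hy]
  have h2 : divDivWeyl G i j y = 0 := by
    simp [divDivWeyl,
      cov3_eq_zero h.isOpen (fun x hx i j k => h.divWeyl_eq_zero hs hC hx i j k) hy]
  simp [bach, h1, h2]

end IsMetricOn

/-! ### The Ricci identity for a gradient -/

/-- The gradient `∇u`, with components `u^l`. -/
noncomputable def grad (G : CoordMetric n) (u : Coord n → ℝ) (l : Fin n) (y : Coord n) : ℝ :=
  ∑ a, ginv G l a y * pd a u y

namespace IsMetricOn

theorem sum_grad_mul_metric (h : IsMetricOn U G) (hy : y ∈ U) (u : Coord n → ℝ) (m : Fin n) :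
    ∑ l, grad G u l y * G y l m = pd m u y := by
  have := congrFun (congrArg (fun M => M *ᵥ (fun a => pd a u y)) (h.mul_inv hy)) m
  simp only [Matrix.one_mulVec, ← Matrix.mulVec_mulVec] at this
  rw [← this, Matrix.mulVec, dotProduct]
  refine Finset.sum_congr rfl fun l _ => ?_
  rw [h.symm hy l m, mul_comm]
  rfl

theorem contract_pd (h : IsMetricOn U G) (hy : y ∈ U) (u : Coord n → ℝ) (X : Fin n → ℝ) :
    ∑ j, ∑ k, ginv G j k y * (pd j u y * X k) = ∑ k, grad G u k y * X k := by
  rw [Finset.sum_comm]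
  refine Finset.sum_congr rfl fun k _ => ?_
  rw [grad, Finset.sum_mul]
  exact Finset.sum_congr rfl fun j _ => by rw [h.ginv_symm hy]; ring

theorem smooth_grad (h : IsMetricOn U G) (hu : SmoothOn U u) (l : Fin n) :
    SmoothOn U (grad G u l) :=
  SmoothOn.sum fun a => (h.smooth_ginv l a).mul (hu.pd h.isOpen a)

/-- Third derivatives and mixed Christoffel terms are symmetric in i, j; what survives is the
curvature matrix acting on du. -/
theorem ricci_identity (h : IsMetricOn U G) (hu : SmoothOn U u) (hy : y ∈ U) (i j k : Fin n) :
    cov2 G (hess G u) i j k y - cov2 G (hess G u) j i k y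
      = ∑ l, grad G u l y * riem G i j k l y := by
  have hp := fun k => hu.pd h.isOpen k
  have e0 : ∑ l, grad G u l y * riem G i j k l y = ∑ m, pd m u y * curvM G i j y m k := by
    simp only [← h.sum_grad_mul_metric hy u, Finset.sum_mul, riem_eq, Matrix.mul_apply,
      Finset.mul_sum]
    rw [Finset.sum_comm]
    exact Finset.sum_congr rfl fun l _ => Finset.sum_congr rfl fun m _ => by ring
  have e1 : ∀ i j, pd i (hess G u j k) y = pd i (pd j (pd k u)) y
      - ∑ m, (pd i (christoffel G m j k) y * pd m u y
        + christoffel G m j k y * pd i (pd m u) y) := by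
    intro i j
    have dc := fun m => (h.smooth_christoffel m j k).diff h.isOpen hy
    have dp := fun m => (hp m).diff h.isOpen hy
    rw [show hess G u j k = fun x => pd j (pd k u) x - ∑ m, christoffel G m j k x * pd m u x
      from rfl, pd_sub i (((hp k).pd h.isOpen j).diff h.isOpen hy)
        (DifferentiableAt.fun_sum fun m _ => (dc m).fun_mul (dp m)),
      pd_sum _ _ fun m => (dc m).fun_mul (dp m)]
    simp only [pd_mul i (dc _) (dp _)]
  have e2 : ∀ i j, ∑ m, christoffel G m i k y * hess G u j m y
      = ∑ m, christoffel G m i k y * pd j (pd m u) y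
        - ∑ m, pd m u y * (connM G j y * connM G i y) m k := by
    intro i j
    simp only [hess, cov1, mul_sub, Finset.sum_sub_distrib, Finset.mul_sum, Matrix.mul_apply]
    congr 1
    rw [Finset.sum_comm]
    refine Finset.sum_congr rfl fun q _ => Finset.sum_congr rfl fun m _ => ?_
    simp only [connM, Matrix.of_apply]
    ring
  have e3 : ∑ m, pd m u y * curvM G i j y m k
      = ∑ m, pd j (christoffel G m i k) y * pd m u y - ∑ m, pd i (christoffel G m j k) y * pd m u y
        + (∑ m, pd m u y * (connM G j y * connM G i y) m k
          - ∑ m, pd m u y * (connM G i y * connM G j y) m k) := by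
    simp only [← Finset.sum_sub_distrib, ← Finset.sum_add_distrib]
    refine Finset.sum_congr rfl fun m _ => ?_
    simp only [curvM, pdM, connM, Matrix.add_apply, Matrix.sub_apply, Matrix.of_apply]
    ring
  rw [e0, e3]
  simp only [cov2, e1, Finset.sum_add_distrib, e2, pd_comm (hp k) h.isOpen hy i j,
    h.christoffel_symm hy _ i j]
  ring

end IsMetricOn

/-! ### Vacuum static metrics in coordinates -/

/-- `(G, u)` solves the vacuum static equation on the open set `U`. -/
structure IsStaticOn (U : Set (Coord n)) (G : CoordMetric n) (u : Coord n → ℝ) : Prop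
    extends IsMetricOn U G where
  smooth_fun : SmoothOn U u
  static : ∀ x ∈ U, ∀ i j, hess G u i j x
    = (ric G i j x - scal G x / ((n : ℝ) - 1) * G x i j) * u x

namespace IsStaticOn

theorem mono (h : IsStaticOn U G u) {V : Set (Coord n)} (hV : IsOpen V) (hVU : V ⊆ U) :
    IsStaticOn V G u :=
  ⟨h.toIsMetricOn.mono hV hVU, h.smooth_fun.mono hVU, fun x hx => h.static x (hVU hx)⟩

theorem cov2_hess (h : IsStaticOn U G u) (hy : y ∈ U) (i j k : Fin n) :
    cov2 G (hess G u) i j k y = pd i u y * ric G j k y + u y * cov2 G (ric G) i j k y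
      - 1 / ((n : ℝ) - 1) * (pd i (scal G) y * u y + scal G y * pd i u y) * G y j k := by
  have dr := fun i j => (h.smooth_ric i j).diff h.isOpen hy
  have ds := h.smooth_scal.diff h.isOpen hy
  have dG := fun i j => (h.smooth i j).diff h.isOpen hy
  have du := h.smooth_fun.diff h.isOpen hy
  have dk := (ds.fun_mul du).const_mul (-(1 / ((n : ℝ) - 1)))
  have e : ∀ j k, ∀ x ∈ U, hess G u j k x
      = u x * ric G j k x + (-(1 / ((n : ℝ) - 1)) * (scal G x * u x)) * G x j k := by
    intro j k x hx
    rw [h.static x hx]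
    ring
  rw [IsMetricOn.cov2_congr_on h.isOpen e hy,
    IsMetricOn.cov2_add (fun i j => du.fun_mul (dr i j)) (fun i j => dk.fun_mul (dG i j)),
    IsMetricOn.cov2_smul du dr, h.cov2_smul_metric hy dk, pd_const_mul _ _ (ds.fun_mul du),
    pd_mul _ ds du]
  ring

theorem sum_grad_mul_riem (h : IsStaticOn U G u) (hy : y ∈ U) (i j k : Fin n) :
    ∑ l, grad G u l y * riem G i j k l y
      = pd i u y * ric G j k y - pd j u y * ric G i k y
        + u y * (cov2 G (ric G) i j k y - cov2 G (ric G) j i k y)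
        - 1 / ((n : ℝ) - 1) * ((pd i (scal G) y * u y + scal G y * pd i u y) * G y j k
          - (pd j (scal G) y * u y + scal G y * pd j u y) * G y i k) := by
  rw [← h.ricci_identity h.smooth_fun hy, h.cov2_hess hy, h.cov2_hess hy]
  ring

/-- Trace `sum_grad_mul_riem` over j and k: the terms r(∇u,·) and s du cancel, and the contracted
Bianchi identity leaves a nonzero multiple of u ds. -/
theorem mul_pd_scal (h : IsStaticOn U G u) (hn : 3 ≤ n) (hy : y ∈ U) (i : Fin n) :
    u y * pd i (scal G) y = 0 := by
  have hn' : (3 : ℝ) ≤ n := by exact_mod_cast hn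
  have n1 : (n : ℝ) - 1 ≠ 0 := by linarith
  have e1 : ∑ j, ∑ k, ginv G j k y * ∑ l, grad G u l y * riem G i j k l y
      = - ∑ l, grad G u l y * ric G i l y := by
    simp only [Finset.mul_sum]
    refine (Finset.sum_congr rfl fun j _ => Finset.sum_comm).trans (Finset.sum_comm.trans ?_)
    rw [← Finset.sum_neg_distrib]
    refine Finset.sum_congr rfl fun l _ => ?_
    simp only [ric, Finset.mul_sum, ← Finset.sum_neg_distrib]
    refine Finset.sum_congr rfl fun j _ => Finset.sum_congr rfl fun k _ => ?_
    rw [IsMetricOn.riem_antisymm_left i j]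
    ring
  have e2 : ∀ j k, ginv G j k y * ∑ l, grad G u l y * riem G i j k l y
      = pd i u y * (ginv G j k y * ric G j k y) - ginv G j k y * (pd j u y * ric G i k y)
        + u y * (ginv G j k y * cov2 G (ric G) i j k y - ginv G j k y * cov2 G (ric G) j k i y)
        - 1 / ((n : ℝ) - 1)
          * ((pd i (scal G) y * u y + scal G y * pd i u y) * (ginv G j k y * G y j k)
          - ginv G j k y * ((pd j (scal G) y * u y + scal G y * pd j u y) * G y i k)) := by
    intro j k
    rw [h.sum_grad_mul_riem hy, h.cov2_ric_symm hy j k i]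
    ring
  have e3 : ∑ j, ∑ k, ginv G j k y * ric G j k y = scal G y := rfl
  simp only [e2, Finset.sum_sub_distrib, Finset.sum_add_distrib, ← Finset.mul_sum,
    h.contract_cov2_ric hy, h.div_ric hy, e3, h.trace_metric hy,
    h.contract_pd hy u (fun k => ric G i k y),
    h.contract_metric hy (fun j => pd j (scal G) y * u y + scal G y * pd j u y)] at e1
  field_simp at e1
  linear_combination -e1

end IsStaticOn

theorem gradTracelessRic_eq (h : IsMetricOn U G) (hy : y ∈ U) (i : Fin n) :
    gradTracelessRic G u i y = ∑ b, grad G u b y * tracelessRic G b i y := by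
  rw [← h.contract_pd hy]
  exact Finset.sum_congr rfl fun a _ => Finset.sum_congr rfl fun b _ => mul_assoc _ _ _

namespace IsStaticOn

/-- The link between the static equation and T: once the s and z parts of R(·,·,·,∇u) are removed,
the terms du∧z and z(∇u,·)∧g remain in the proportion that defines T. -/
theorem sum_grad_mul_weyl (h : IsStaticOn U G u) (hn : 3 ≤ n) (hy : y ∈ U)
    (hs : ∀ i, pd i (scal G) y = 0) (i j k : Fin n) :
    ∑ l, grad G u l y * weyl G i j k l y
      = u y * cotton G i j k y + ((n : ℝ) - 1) * tensorT G u i j k y := by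
  have hn' : (3 : ℝ) ≤ n := by exact_mod_cast hn
  have n0 : (n : ℝ) ≠ 0 := by linarith
  have n1 : (n : ℝ) - 1 ≠ 0 := by linarith
  have n2 : (n : ℝ) - 2 ≠ 0 := by linarith
  have e : ∀ l, grad G u l y * weyl G i j k l y = grad G u l y * riem G i j k l y
      - scal G y / ((n : ℝ) * ((n : ℝ) - 1)) * (G y i k * (grad G u l y * G y l j)
        - G y j k * (grad G u l y * G y l i))
      - 1 / ((n : ℝ) - 2) * (tracelessRic G i k y * (grad G u l y * G y l j)
        + G y i k * (grad G u l y * tracelessRic G l j y)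
        - G y j k * (grad G u l y * tracelessRic G l i y)
        - tracelessRic G j k y * (grad G u l y * G y l i)) := by
    intro l
    simp only [weyl, h.symm hy l, h.tracelessRic_symm hy l]
    ring
  simp only [e, Finset.sum_sub_distrib, Finset.sum_add_distrib, ← Finset.mul_sum,
    h.sum_grad_mul_riem hy, h.sum_grad_mul_metric hy, ← gradTracelessRic_eq h.toIsMetricOn hy,
    tensorT, cotton, hs]
  simp only [tracelessRic]
  field_simp
  ring

end IsStaticOn

/-- The squared length `|∇u|²`. -/
noncomputable def normSqGrad (G : CoordMetric n) (u : Coord n → ℝ) (y : Coord n) : ℝ :=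
  ∑ i, grad G u i y * pd i u y

/-- The component `z(∇u, ∇u)`. -/
noncomputable def tracelessRicGrad (G : CoordMetric n) (u : Coord n → ℝ) (y : Coord n) : ℝ :=
  ∑ i, grad G u i y * gradTracelessRic G u i y

/-! ### Algebraic consequences of T = 0. -/

namespace IsMetricOn

theorem normSqGrad_ne_zero (h : IsMetricOn U G) (hy : y ∈ U) {i : Fin n} (hi : pd i u y ≠ 0) :
    normSqGrad G u y ≠ 0 := by
  have hpos := (h.posDef y hy).inv
  have hv : (fun a => pd a u y) ≠ 0 := fun h0 => hi (congrFun h0 i)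
  have := hpos.dotProduct_mulVec_pos hv
  refine ne_of_gt (this.trans_eq ?_)
  simp only [dotProduct, Matrix.mulVec, normSqGrad, grad]
  exact Finset.sum_congr rfl fun a _ => by simp [ginv, mul_comm]

theorem smooth_gradTracelessRic (h : IsMetricOn U G) (hu : SmoothOn U u) (i : Fin n) :
    SmoothOn U (gradTracelessRic G u i) :=
  SmoothOn.sum fun a => SmoothOn.sum fun b =>
    ((h.smooth_ginv a b).mul (hu.pd h.isOpen a)).mul (h.smooth_tracelessRic b i)

theorem smooth_normSqGrad (h : IsMetricOn U G) (hu : SmoothOn U u) :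
    SmoothOn U (normSqGrad G u) :=
  SmoothOn.sum fun i => (h.smooth_grad hu i).mul (hu.pd h.isOpen i)

theorem smooth_tracelessRicGrad (h : IsMetricOn U G) (hu : SmoothOn U u) :
    SmoothOn U (tracelessRicGrad G u) :=
  SmoothOn.sum fun i => (h.smooth_grad hu i).mul (h.smooth_gradTracelessRic hu i)

/-- If `T = 0`, then `z` is diagonal with respect to `∇u`, with a single eigenvalue on its
orthogonal complement. -/
theorem tracelessRic_eq_of_tensorT (h : IsMetricOn U G) (hn : 3 ≤ n) (hy : y ∈ U)
    (hT : ∀ i j k, tensorT G u i j k y = 0) (hw : normSqGrad G u y ≠ 0) (j k : Fin n) :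
    tracelessRic G j k y
      = (1 + 1 / ((n : ℝ) - 1)) * tracelessRicGrad G u y / normSqGrad G u y ^ 2
          * (pd j u y * pd k u y)
        + -(1 / ((n : ℝ) - 1) * tracelessRicGrad G u y / normSqGrad G u y) * G y j k := by
  have hn' : (3 : ℝ) ≤ n := by exact_mod_cast hn
  have n1 : (n : ℝ) - 1 ≠ 0 := by linarith
  have n2 : (n : ℝ) - 2 ≠ 0 := by linarith
  have hT' : ∀ i j k, pd i u y * tracelessRic G j k y - pd j u y * tracelessRic G i k y
      + 1 / ((n : ℝ) - 1) *
        (gradTracelessRic G u i y * G y j k - gradTracelessRic G u j y * G y i k) = 0 := by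
    intro i j k
    have := congrArg (((n : ℝ) - 2) * ·) (hT i j k)
    simp only [tensorT, mul_zero] at this
    rw [← this]
    field_simp
  -- Contraction of T = 0 with ∇u in the first slot.
  have c1 : ∀ j k, normSqGrad G u y * tracelessRic G j k y
      - pd j u y * gradTracelessRic G u k y
      + 1 / ((n : ℝ) - 1) * (tracelessRicGrad G u y * G y j k
        - gradTracelessRic G u j y * pd k u y) = 0 := by
    intro j k
    have : ∑ i, grad G u i y * (pd i u y * tracelessRic G j k y
      - pd j u y * tracelessRic G i k y + 1 / ((n : ℝ) - 1) *
        (gradTracelessRic G u i y * G y j k - gradTracelessRic G u j y * G y i k)) = 0 :=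
      Finset.sum_eq_zero fun i _ => by rw [hT' i j k, mul_zero]
    rw [← this, gradTracelessRic_eq h hy k, ← h.sum_grad_mul_metric hy u k, normSqGrad,
      tracelessRicGrad]
    simp only [Finset.mul_sum, Finset.sum_mul, ← Finset.sum_sub_distrib,
      ← Finset.sum_add_distrib]
    exact Finset.sum_congr rfl fun i _ => by ring
  -- A second contraction with ∇u makes ∇u an eigenvector of z; the common factor is 1 - 1/(n-1),
  -- nonzero because n ≥ 3.
  have c2 : ∀ j, normSqGrad G u y * gradTracelessRic G u j y
      = tracelessRicGrad G u y * pd j u y := by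
    intro j
    have e : ∑ k, grad G u k y * (normSqGrad G u y * tracelessRic G j k y
      - pd j u y * gradTracelessRic G u k y
      + 1 / ((n : ℝ) - 1) * (tracelessRicGrad G u y * G y j k
        - gradTracelessRic G u j y * pd k u y))
      = normSqGrad G u y * (∑ k, grad G u k y * tracelessRic G k j y)
        - pd j u y * (∑ k, grad G u k y * gradTracelessRic G u k y)
        + 1 / ((n : ℝ) - 1) * (tracelessRicGrad G u y * (∑ k, grad G u k y * G y k j)
        - gradTracelessRic G u j y * (∑ k, grad G u k y * pd k u y)) := by
      simp only [Finset.mul_sum, ← Finset.sum_sub_distrib,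
        ← Finset.sum_add_distrib]
      exact Finset.sum_congr rfl fun k _ => by
        rw [h.symm hy k j, h.tracelessRic_symm hy k j]; ring
    have e0 := e.symm.trans (Finset.sum_eq_zero fun k _ => by rw [c1 j k, mul_zero])
    rw [← gradTracelessRic_eq h hy j, h.sum_grad_mul_metric hy, ← normSqGrad,
      ← tracelessRicGrad] at e0
    field_simp at e0
    have e1 : ((n : ℝ) - 2) * (normSqGrad G u y * gradTracelessRic G u j y
      - tracelessRicGrad G u y * pd j u y) = 0 := by linear_combination e0
    exact sub_eq_zero.mp ((mul_eq_zero.mp e1).resolve_left n2)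
  have c3 : normSqGrad G u y ^ 2 * tracelessRic G j k y
      = (1 + 1 / ((n : ℝ) - 1)) * tracelessRicGrad G u y * (pd j u y * pd k u y)
        - 1 / ((n : ℝ) - 1) * tracelessRicGrad G u y * normSqGrad G u y * G y j k := by
    linear_combination normSqGrad G u y * c1 j k + pd j u y * c2 k
      + 1 / ((n : ℝ) - 1) * pd k u y * c2 j
  have : tracelessRic G j k y = (normSqGrad G u y ^ 2 * tracelessRic G j k y)
      / normSqGrad G u y ^ 2 := by field_simp
  rw [this, c3]
  field_simp
  ring

/-- Both traces of Dr that occur are multiples of ds, by the contracted Bianchi identity. -/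
theorem contract_cotton (h : IsMetricOn U G) (hy : y ∈ U)
    (hs : ∀ i, pd i (scal G) y = 0) (i : Fin n) :
    ∑ j, ∑ k, ginv G j k y * cotton G i j k y = 0 := by
  have e : ∀ j k, ginv G j k y * cotton G i j k y
      = ginv G j k y * cov2 G (ric G) i j k y - ginv G j k y * cov2 G (ric G) j k i y := by
    intro j k
    rw [cotton, hs, hs, h.cov2_ric_symm hy j k i]
    ring
  simp only [e, Finset.sum_sub_distrib, h.contract_cov2_ric hy, h.div_ric hy, hs]
  ring

end IsMetricOn

namespace IsStaticOn

/-- With T = 0, uC is W(·,·,·,∇u), and W(·,·,∇u,∇u) vanishes by antisymmetry. -/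
theorem sum_grad_mul_cotton (h : IsStaticOn U G u) (hn : 3 ≤ n) (hy : y ∈ U)
    (hs : ∀ i, pd i (scal G) y = 0) (hT : ∀ i j k, tensorT G u i j k y = 0) (hu : u y ≠ 0)
    (i j : Fin n) : ∑ k, grad G u k y * cotton G i j k y = 0 := by
  have hW : ∀ k, u y * cotton G i j k y = ∑ l, grad G u l y * weyl G i j k l y := by
    intro k
    rw [h.sum_grad_mul_weyl hn hy hs, hT, mul_zero, add_zero]
  have e : u y * ∑ k, grad G u k y * cotton G i j k y
      = ∑ k, ∑ l, grad G u k y * grad G u l y * weyl G i j k l y := by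
    rw [Finset.mul_sum]
    refine Finset.sum_congr rfl fun k _ => ?_
    rw [mul_left_comm, hW, Finset.mul_sum]
    exact Finset.sum_congr rfl fun l _ => by ring
  have e' : ∑ k, ∑ l, grad G u k y * grad G u l y * weyl G i j k l y
      = - ∑ k, ∑ l, grad G u k y * grad G u l y * weyl G i j k l y := by
    conv_lhs => rw [Finset.sum_comm]
    simp only [← Finset.sum_neg_distrib]
    exact Finset.sum_congr rfl fun k _ => Finset.sum_congr rfl fun l _ => by
      rw [h.weyl_antisymm_right hy i j l k]; ring
  have : u y * ∑ k, grad G u k y * cotton G i j k y = 0 := by linarith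
  exact (mul_eq_zero.mp this).resolve_left hu

/-- The g part of r contracts with W to its trace; the du⊗du part puts ∇u in the last slot of W,
where `sum_grad_mul_weyl` gives zero. -/
theorem weylRic_eq_zero (h : IsStaticOn U G u) (hn : 3 ≤ n) (hy : y ∈ U)
    (hC : ∀ i j k, cotton G i j k y = 0)
    (hs : ∀ i, pd i (scal G) y = 0) (hT : ∀ i j k, tensorT G u i j k y = 0)
    {a b : ℝ} (hr : ∀ p q, ric G p q y = a * (pd p u y * pd q u y) + b * G y p q)
    (i j : Fin n) : weylRic G i j y = 0 := by
  have e : ∀ k l, ∑ p, ∑ q, ginv G k p y * ginv G l q y * weyl G i k j l y * ric G p q y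
      = a * (grad G u k y * (grad G u l y * weyl G i k j l y))
        + b * (ginv G k l y * weyl G i k j l y) := by
    intro k l
    have e1 : ∑ p, ∑ q, ginv G k p y * ginv G l q y * G y p q = ginv G k l y := by
      have : ∀ p, ∑ q, ginv G k p y * ginv G l q y * G y p q
          = ginv G k p y * if l = p then 1 else 0 := by
        intro p
        rw [← h.sum_ginv_mul_metric' hy l p, Finset.mul_sum]
        exact Finset.sum_congr rfl fun q _ => by ring
      simp [this]
    have e2 : ∑ p, ∑ q, ginv G k p y * ginv G l q y * (pd p u y * pd q u y)
        = grad G u k y * grad G u l y := by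
      rw [grad, grad, Finset.sum_mul_sum]
      exact Finset.sum_congr rfl fun p _ => Finset.sum_congr rfl fun q _ => by ring
    rw [← mul_assoc (grad G u k y), ← e2, ← e1]
    simp only [Finset.sum_mul, Finset.mul_sum, ← Finset.sum_add_distrib]
    refine Finset.sum_congr rfl fun p _ => Finset.sum_congr rfl fun q _ => ?_
    rw [hr]
    ring
  simp only [weylRic, e, Finset.sum_add_distrib, ← Finset.mul_sum, h.contract_weyl hy hn,
    h.sum_grad_mul_weyl hn hy hs, hC, hT]
  simp

/-- The Cotton tensor vanishes where `u` and `du` do not. -/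
theorem cotton_eq_zero (h : IsStaticOn U G u) (hn : 3 ≤ n)
    (hs : ∀ x ∈ U, ∀ i, pd i (scal G) x = 0) (hT : ∀ x ∈ U, ∀ i j k, tensorT G u i j k x = 0)
    (hu : ∀ x ∈ U, u x ≠ 0) (hw : ∀ x ∈ U, normSqGrad G u x ≠ 0) (hy : y ∈ U) (i j k : Fin n) :
    cotton G i j k y = 0 := by
  have hn' : (3 : ℝ) ≤ n := by exact_mod_cast hn
  have n0 : (n : ℝ) ≠ 0 := by linarith
  have n1 : (n : ℝ) - 1 ≠ 0 := by linarith
  have n2 : (n : ℝ) - 2 ≠ 0 := by linarith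
  set a : Coord n → ℝ := fun x =>
    (1 + 1 / ((n : ℝ) - 1)) * tracelessRicGrad G u x / normSqGrad G u x ^ 2 with ha
  set b : Coord n → ℝ := fun x =>
    -(1 / ((n : ℝ) - 1) * tracelessRicGrad G u x / normSqGrad G u x) with hb
  have hz : ∀ x ∈ U, ∀ j k, tracelessRic G j k x
      = a x * (pd j u x * pd k u x) + b x * G x j k := fun x hx j k =>
    h.tracelessRic_eq_of_tensorT hn hx (hT x hx) (hw x hx) j k
  have sa : SmoothOn U a := (contDiffOn_const.mul (h.smooth_tracelessRicGrad h.smooth_fun)).div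
    ((h.smooth_normSqGrad h.smooth_fun).pow 2) fun x hx => pow_ne_zero 2 (hw x hx)
  have sb : SmoothOn U b := ((contDiffOn_const.mul (h.smooth_tracelessRicGrad h.smooth_fun)).div
    (h.smooth_normSqGrad h.smooth_fun) hw).neg
  have da := sa.diff h.isOpen hy
  have db := sb.diff h.isOpen hy
  have dp := fun j => (h.smooth_fun.pd h.isOpen j).diff h.isOpen hy
  have dG := fun i j => (h.smooth i j).diff h.isOpen hy
  have ds := h.smooth_scal.diff h.isOpen hy
  -- From here only the smoothness of a, b and the form z = a du⊗du + b g matter.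
  clear_value a b
  set p : Fin n → ℝ := fun j => pd j u y with hp
  -- The coefficient of g in r - s/(n-1) g, namely b + s/n - s/(n-1).
  set κ : ℝ := b y - scal G y / (n * ((n : ℝ) - 1)) with hκ
  have hhess : ∀ j k, hess G u j k y = u y * (a y * (p j * p k) + κ * G y j k) := by
    intro j k
    have := hz y hy j k
    rw [tracelessRic] at this
    rw [h.static y hy, hκ]
    have e : scal G y / ((n : ℝ) - 1) - scal G y / n = scal G y / (n * ((n : ℝ) - 1)) := by
      field_simp
      ring
    linear_combination u y * this - u y * G y j k * e
  have hcov : ∀ i j k, cov2 G (ric G) i j k y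
      = pd i a y * (p j * p k) + a y * (hess G u i j y * p k + p j * hess G u i k y)
        + pd i b y * G y j k := by
    intro i j k
    have e : ∀ j k, ∀ x ∈ U, ric G j k x
        = a x * (pd j u x * pd k u x) + (b x + 1 / (n : ℝ) * scal G x) * G x j k := by
      intro j k x hx
      have := hz x hx j k
      rw [tracelessRic] at this
      linear_combination this
    rw [IsMetricOn.cov2_congr_on h.isOpen e hy,
      IsMetricOn.cov2_add (fun j k => da.fun_mul ((dp j).fun_mul (dp k)))
        (fun j k => (db.fun_add (ds.const_mul _)).fun_mul (dG j k)),
      IsMetricOn.cov2_smul da (fun j k => (dp j).fun_mul (dp k)), IsMetricOn.cov2_mul_self dp,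
      h.cov2_smul_metric hy (db.fun_add (ds.const_mul _)), pd_add _ db (ds.const_mul _),
      pd_const_mul _ _ ds, hs y hy]
    simp only [hess, hp]
    ring
  -- In the antisymmetrized Dr the cubic terms in du cancel; the g part of the Hessian contributes
  -- -a u κ du, which joins db.
  set μ : Fin n → ℝ := fun i => pd i b y - a y * u y * κ * p i with hμ
  have hC : ∀ i j k, cotton G i j k y = (pd i a y * p j - pd j a y * p i) * p k
      + μ i * G y j k - μ j * G y i k := by
    intro i j k
    rw [cotton, hcov, hcov, hs y hy, hs y hy]
    simp only [hhess, hμ, h.symm hy j i]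
    ring
  set w : ℝ := normSqGrad G u y with hwdef
  have hw0 : w ≠ 0 := hw y hy
  set A : ℝ := ∑ k, grad G u k y * pd k a y with hA
  -- The vanishing trace of C; `t2` below is C(·,·,∇u) = 0.
  have t1 : ∀ i, w * pd i a y - A * p i + ((n : ℝ) - 1) * μ i = 0 := by
    intro i
    have e := h.contract_cotton hy (hs y hy) i
    have e' : ∀ j k, ginv G j k y * cotton G i j k y
        = pd i a y * (ginv G j k y * (pd j u y * p k))
          - p i * (ginv G j k y * (pd k u y * pd j a y))
          + μ i * (ginv G j k y * G y j k) - ginv G j k y * (μ j * G y i k) := by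
      intro j k
      rw [hC]
      ring
    simp only [e', Finset.sum_sub_distrib, Finset.sum_add_distrib, ← Finset.mul_sum,
      h.trace_metric hy, h.contract_metric hy μ, h.contract_pd hy u p,
      h.contract_swap hy (fun j k => pd j u y * pd k a y),
      h.contract_pd hy u (fun k => pd k a y)] at e
    rw [← hA, show ∑ k, grad G u k y * p k = w from rfl] at e
    linear_combination e
  have t2 : ∀ i j, (pd i a y * p j - pd j a y * p i) * w + μ i * p j - μ j * p i = 0 := by
    intro i j
    have e := h.sum_grad_mul_cotton hn hy (hs y hy) (hT y hy) (hu y hy) i j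
    have e' : ∀ k, grad G u k y * cotton G i j k y
        = (pd i a y * p j - pd j a y * p i) * (grad G u k y * pd k u y)
          + μ i * (grad G u k y * G y k j) - μ j * (grad G u k y * G y k i) := by
      intro k
      rw [hC, h.symm hy k i, h.symm hy k j]
      ring
    simp only [e', Finset.sum_sub_distrib, Finset.sum_add_distrib, ← Finset.mul_sum,
      h.sum_grad_mul_metric hy] at e
    exact e
  -- Wedging `t1` with du removes A; eliminating μ∧du against `t2` leaves (n-2) w da∧du = 0.
  have t3 : ∀ i j, pd i a y * p j - pd j a y * p i = 0 := by
    intro i j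
    have : ((n : ℝ) - 2) * (w * (pd i a y * p j - pd j a y * p i)) = 0 := by
      linear_combination ((n : ℝ) - 1) * t2 i j - p j * t1 i + p i * t1 j
    exact ((mul_eq_zero.mp ((mul_eq_zero.mp this).resolve_left n2)).resolve_left hw0)
  have t4 : ∀ i, w * pd i a y = A * p i := by
    intro i
    have : ∑ j, grad G u j y * (pd i a y * p j - pd j a y * p i) = w * pd i a y - A * p i := by
      rw [hwdef, normSqGrad, hA, Finset.sum_mul, Finset.sum_mul, ← Finset.sum_sub_distrib]
      exact Finset.sum_congr rfl fun j _ => by rw [hp]; ring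
    rw [← sub_eq_zero, ← this]
    exact Finset.sum_eq_zero fun j _ => by rw [t3, mul_zero]
  have t5 : ∀ i, μ i = 0 := by
    intro i
    have : ((n : ℝ) - 1) * μ i = 0 := by linear_combination t1 i - t4 i
    exact (mul_eq_zero.mp this).resolve_left n1
  rw [hC, t3, t5, t5]
  ring

end IsStaticOn

/-! ### Vanishing of the Cotton and Bach tensors -/

theorem eq_zero_of_dense {F : Coord n → ℝ} (hU : IsOpen U) (hF : ContinuousOn F U)
    (hd : ∀ V ⊆ U, IsOpen V → V.Nonempty → ∃ x ∈ V, F x = 0) (hy : y ∈ U) : F y = 0 := by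
  by_contra hne
  have hV : IsOpen (U ∩ F ⁻¹' {0}ᶜ) := hF.isOpen_inter_preimage hU isOpen_compl_singleton
  obtain ⟨x, hx, hx0⟩ := hd _ Set.inter_subset_left hV ⟨y, hy, hne⟩
  exact hx.2 hx0

namespace IsStaticOn

theorem pd_scal_eq_zero (h : IsStaticOn U G u) (hn : 3 ≤ n)
    (hd : ∀ V ⊆ U, IsOpen V → V.Nonempty → ∃ x ∈ V, u x ≠ 0) (hy : y ∈ U) (i : Fin n) :
    pd i (scal G) y = 0 := by
  refine eq_zero_of_dense h.isOpen (h.smooth_scal.pd h.isOpen i).continuousOn ?_ hy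
  intro V hVU hV hne
  obtain ⟨x, hx, hux⟩ := hd V hVU hV hne
  exact ⟨x, hx, (mul_eq_zero.mp (h.mul_pd_scal hn (hVU hx) i)).resolve_left hux⟩

/-- Here Ddu = 0, so r = s/(n-1) g; the trace s = ns/(n-1) forces s = 0. -/
theorem ric_eq_zero (h : IsStaticOn U G u) (hn : 3 ≤ n) (hu : ∀ x ∈ U, u x ≠ 0)
    (hp : ∀ x ∈ U, ∀ i, pd i u x = 0) (hy : y ∈ U) (i j : Fin n) : ric G i j y = 0 := by
  have hn' : (3 : ℝ) ≤ n := by exact_mod_cast hn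
  have n1 : (n : ℝ) - 1 ≠ 0 := by linarith
  have hh : ∀ i j, ric G i j y = scal G y / ((n : ℝ) - 1) * G y i j := by
    intro i j
    have e := h.static y hy i j
    rw [hess, cov1, pd_eq_zero_of_on h.isOpen (fun x hx => hp x hx j) hy] at e
    simp only [hp y hy, mul_zero, Finset.sum_const_zero, sub_zero] at e
    exact sub_eq_zero.mp ((mul_eq_zero.mp e.symm).resolve_right (hu y hy))
  have hsc : scal G y = scal G y / ((n : ℝ) - 1) * ∑ k, ∑ l, ginv G k l y * G y k l := by
    nth_rewrite 1 [scal]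
    simp only [Finset.mul_sum]
    exact Finset.sum_congr rfl fun k _ => Finset.sum_congr rfl fun l _ => by rw [hh]; ring
  rw [h.trace_metric hy] at hsc
  field_simp at hsc
  have : scal G y = 0 := by linarith
  rw [hh, this]
  ring

/-- Every nonempty open set contains a point at which `C` and `W(r)` vanish. -/
theorem exists_cotton_weylRic_eq_zero (h : IsStaticOn U G u) (hn : 3 ≤ n)
    (hd : ∀ V ⊆ U, IsOpen V → V.Nonempty → ∃ x ∈ V, u x ≠ 0)
    (hT : ∀ x ∈ U, ∀ i j k, tensorT G u i j k x = 0) (hne : U.Nonempty) :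
    ∃ x ∈ U, (∀ i j k, cotton G i j k x = 0) ∧ ∀ i j, weylRic G i j x = 0 := by
  have hs : ∀ x ∈ U, ∀ i, pd i (scal G) x = 0 := fun x hx i => h.pd_scal_eq_zero hn hd hx i
  set V := U ∩ u ⁻¹' {0}ᶜ with hVdef
  have hV : IsOpen V :=
    h.smooth_fun.continuousOn.isOpen_inter_preimage h.isOpen isOpen_compl_singleton
  obtain ⟨x₀, hx₀, hux₀⟩ := hd U subset_rfl h.isOpen hne
  have hVU : V ⊆ U := Set.inter_subset_left
  by_cases hp : ∀ x ∈ V, ∀ i, pd i u x = 0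
  · have hV' := h.mono hV hVU
    have hr : ∀ x ∈ V, ∀ i j, ric G i j x = 0 := fun x hx i j =>
      hV'.ric_eq_zero hn (fun x hx => hx.2) hp hx i j
    refine ⟨x₀, hx₀, fun i j k => ?_, fun i j => ?_⟩
    · have hc : ∀ i j k, cov2 G (ric G) i j k x₀ = 0 := by
        intro i j k
        rw [cov2, pd_eq_zero_of_on hV (fun x hx => hr x hx j k) ⟨hx₀, hux₀⟩]
        simp [hr x₀ ⟨hx₀, hux₀⟩]
      rw [cotton, hc, hc, hs x₀ hx₀, hs x₀ hx₀]
      ring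
    · simp [weylRic, hr x₀ ⟨hx₀, hux₀⟩]
  · push Not at hp
    obtain ⟨x₁, hx₁, i, hi⟩ := hp
    -- C involves derivatives of r, so the form of z is needed on a whole neighbourhood of x₁; W(r)
    -- is then handled at x₁ alone.
    set V' := V ∩ normSqGrad G u ⁻¹' {0}ᶜ with hV'def
    have hVV' : V' ⊆ U := Set.inter_subset_left.trans hVU
    have hV' : IsOpen V' := ((h.smooth_normSqGrad h.smooth_fun).continuousOn.mono
      hVU).isOpen_inter_preimage hV isOpen_compl_singleton
    have hx₁' : x₁ ∈ V' := ⟨hx₁, h.normSqGrad_ne_zero (hVU hx₁) hi⟩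
    have h' := h.mono hV' hVV'
    have hC : ∀ i j k, cotton G i j k x₁ = 0 := fun i j k =>
      h'.cotton_eq_zero hn (fun x hx => hs x (hVV' hx)) (fun x hx => hT x (hVV' hx))
        (fun x hx => hx.1.2) (fun x hx => hx.2) hx₁' i j k
    refine ⟨x₁, hVU hx₁, hC, fun i j => ?_⟩
    refine h.weylRic_eq_zero hn (hVU hx₁) hC (hs x₁ (hVU hx₁)) (hT x₁ (hVU hx₁))
      (a := (1 + 1 / ((n : ℝ) - 1)) * tracelessRicGrad G u x₁ / normSqGrad G u x₁ ^ 2)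
      (b := -(1 / ((n : ℝ) - 1) * tracelessRicGrad G u x₁ / normSqGrad G u x₁)
        + scal G x₁ / (n : ℝ)) (fun p q => ?_) i j
    have := h.tracelessRic_eq_of_tensorT hn (hVU hx₁) (hT x₁ (hVU hx₁)) hx₁'.2 p q
    rw [tracelessRic] at this
    linear_combination this

/-- Density is applied to C and W(r) separately: B reduces to W(r) only after C is known to vanish
on all of U. -/
theorem cotton_and_bach_eq_zero (h : IsStaticOn U G u) (hn : 3 ≤ n)
    (hd : ∀ V ⊆ U, IsOpen V → V.Nonempty → ∃ x ∈ V, u x ≠ 0)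
    (hT : ∀ x ∈ U, ∀ i j k, tensorT G u i j k x = 0) (hy : y ∈ U) :
    (∀ i j, bach G i j y = 0) ∧ ∀ i j k, cotton G i j k y = 0 := by
  have key : ∀ V ⊆ U, IsOpen V → V.Nonempty →
      ∃ x ∈ V, (∀ i j k, cotton G i j k x = 0) ∧ ∀ i j, weylRic G i j x = 0 :=
    fun V hVU hV hne => (h.mono hV hVU).exists_cotton_weylRic_eq_zero hn
      (fun V' hV' => hd V' (hV'.trans hVU)) (fun x hx => hT x (hVU hx)) hne
  have hC : ∀ x ∈ U, ∀ i j k, cotton G i j k x = 0 := fun x hx i j k =>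
    eq_zero_of_dense h.isOpen (h.smooth_cotton i j k).continuousOn
      (fun V hVU hV hne => (key V hVU hV hne).imp fun x hx => ⟨hx.1, hx.2.1 i j k⟩) hx
  have hW : ∀ i j, weylRic G i j y = 0 := fun i j =>
    eq_zero_of_dense h.isOpen (h.smooth_weylRic i j).continuousOn
      (fun V hVU hV hne => (key V hVU hV hne).imp fun x hx => ⟨hx.1, hx.2.2 i j⟩) hy
  refine ⟨fun i j => ?_, hC y hy⟩
  rw [h.bach_eq (fun x hx i => h.pd_scal_eq_zero hn hd hx i) hC hy, hW, mul_zero]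

end IsStaticOn

/-! ### Unique continuation -/

theorem fderiv_apply_eq_sum (F : Coord n → ℝ) (x v : Coord n) :
    fderiv ℝ F x v = ∑ i, v i * pd i F x := by
  have hv : v = ∑ i, v i • (EuclideanSpace.single i 1 : Coord n) := by
    simpa using ((EuclideanSpace.basisFun (Fin n) ℝ).sum_repr v).symm
  nth_rewrite 1 [hv]
  simp [map_sum, pd]

theorem hasDerivAt_line {F : Coord n → ℝ} {x v : Coord n} {t : ℝ}
    (hF : DifferentiableAt ℝ F (x + t • v)) :
    HasDerivAt (fun s : ℝ => F (x + s • v)) (∑ i, v i * pd i F (x + t • v)) t := by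
  have h1 : HasDerivAt (fun s : ℝ => x + s • v) v t := by
    simpa using ((hasDerivAt_id t).smul_const v).const_add x
  rw [← fderiv_apply_eq_sum]
  exact hF.hasFDerivAt.comp_hasDerivAt t h1

namespace IsStaticOn

/-- The static equation as a closed linear first-order system for the 1-jet (u, du). -/
theorem pd_pd (h : IsStaticOn U G u) (hy : y ∈ U) (i j : Fin n) :
    pd i (pd j u) y = (ric G i j y - scal G y / ((n : ℝ) - 1) * G y i j) * u y
      + ∑ m, christoffel G m i j y * pd m u y := by
  rw [← h.static y hy, hess, cov1]
  ring

/-- A solution whose `1`-jet vanishes at an end point of a segment vanishes at the other one. -/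
theorem eq_zero_of_segment (h : IsStaticOn U G u) {x v : Coord n}
    (hseg : ∀ t ∈ Set.Icc (0 : ℝ) 1, x + t • v ∈ U) (h0 : u x = 0) (h1 : ∀ i, pd i u x = 0) :
    u (x + v) = 0 := by
  set c : Fin n → Fin n → Coord n → ℝ := fun i j x =>
    ric G i j x - scal G x / ((n : ℝ) - 1) * G x i j with hc
  have sc : ∀ i j, SmoothOn U (c i j) := fun i j =>
    (h.smooth_ric i j).sub ((h.smooth_scal.div_const _).mul (h.smooth i j))
  set J : ℝ → ℝ × (Fin n → ℝ) := fun t => (u (x + t • v), fun j => pd j u (x + t • v)) with hJ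
  set J' : ℝ → ℝ × (Fin n → ℝ) := fun t => (∑ i, v i * pd i u (x + t • v),
    fun j => ∑ i, v i * pd i (pd j u) (x + t • v)) with hJ'
  have hderiv : ∀ t ∈ Set.Icc (0 : ℝ) 1, HasDerivAt J (J' t) t := fun t ht =>
    (hasDerivAt_line (h.smooth_fun.diff h.isOpen (hseg t ht))).prodMk
      (hasDerivAt_pi.mpr fun j => hasDerivAt_line
        ((h.smooth_fun.pd h.isOpen j).diff h.isOpen (hseg t ht)))
  -- The summand 1 bounds the derivative of u, the inner sums those of the components of du. By
  -- compactness of [0, 1] this is bounded by a constant K, as Grönwall's inequality requires.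
  set b : ℝ → ℝ := fun t => ∑ i, |v i| * (1 + ∑ j, (|c i j (x + t • v)|
    + ∑ m, |christoffel G m i j (x + t • v)|)) with hb
  have hline : ContinuousOn (fun t : ℝ => x + t • v) (Set.Icc 0 1) := by fun_prop
  have hcomp : ∀ F : Coord n → ℝ, SmoothOn U F →
      ContinuousOn (fun t : ℝ => |F (x + t • v)|) (Set.Icc 0 1) := fun F hF =>
    (hF.continuousOn.comp hline hseg).abs
  have hbc : ContinuousOn b (Set.Icc 0 1) := by
    refine continuousOn_finsetSum _ fun i _ => continuousOn_const.mul
      (continuousOn_const.add (continuousOn_finsetSum _ fun j _ => (hcomp _ (sc i j)).add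
        (continuousOn_finsetSum _ fun m _ => hcomp _ (h.smooth_christoffel m i j))))
  obtain ⟨K, hK⟩ := isCompact_Icc.exists_bound_of_continuousOn hbc
  have bound : ∀ t ∈ Set.Icc (0 : ℝ) 1, ‖J' t‖ ≤ b t * ‖J t‖ := by
    intro t ht
    have j0 : |u (x + t • v)| ≤ ‖J t‖ := norm_fst_le (J t)
    have j1 : ∀ j, |pd j u (x + t • v)| ≤ ‖J t‖ := fun j =>
      (norm_le_pi_norm (J t).2 j).trans (norm_snd_le (J t))
    have nn : ∀ i j, 0 ≤ |c i j (x + t • v)| + ∑ m, |christoffel G m i j (x + t • v)| :=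
      fun i j => by positivity
    rw [hb, Finset.sum_mul]
    refine norm_prod_le_iff.mpr ⟨?_, ?_⟩
    · change |∑ i, v i * pd i u (x + t • v)| ≤ _
      refine (Finset.abs_sum_le_sum_abs _ _).trans (Finset.sum_le_sum fun i _ => ?_)
      rw [abs_mul, mul_assoc]
      refine mul_le_mul_of_nonneg_left ?_ (abs_nonneg _)
      refine (j1 i).trans (le_mul_of_one_le_left (norm_nonneg _) ?_)
      have := Finset.sum_nonneg fun j (_ : j ∈ Finset.univ) => nn i j
      linarith
    · refine (pi_norm_le_iff_of_nonneg
        (Finset.sum_nonneg fun i _ => by have := nn i; positivity)).mpr fun j => ?_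
      change |∑ i, v i * pd i (pd j u) (x + t • v)| ≤ _
      refine (Finset.abs_sum_le_sum_abs _ _).trans (Finset.sum_le_sum fun i _ => ?_)
      rw [abs_mul, mul_assoc]
      refine mul_le_mul_of_nonneg_left ?_ (abs_nonneg _)
      have e1 : |pd i (pd j u) (x + t • v)| ≤ (|c i j (x + t • v)|
          + ∑ m, |christoffel G m i j (x + t • v)|) * ‖J t‖ := by
        rw [h.pd_pd (hseg t ht), add_mul, Finset.sum_mul]
        refine (abs_add_le _ _).trans (add_le_add ?_ ?_)
        · rw [abs_mul]
          exact mul_le_mul_of_nonneg_left j0 (abs_nonneg _)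
        · refine (Finset.abs_sum_le_sum_abs _ _).trans (Finset.sum_le_sum fun m _ => ?_)
          rw [abs_mul]
          exact mul_le_mul_of_nonneg_left (j1 m) (abs_nonneg _)
      refine e1.trans (mul_le_mul_of_nonneg_right ?_ (norm_nonneg _))
      have := Finset.single_le_sum (fun j (_ : j ∈ Finset.univ) => nn i j) (Finset.mem_univ j)
      linarith
  have hzero := eq_zero_of_abs_deriv_le_mul_abs_self_of_eq_zero_right (f := J) (f' := J')
    (K := K) (a := 0) (b := 1)
    (fun t ht => (hderiv t ht).continuousAt.continuousWithinAt)
    (fun t ht => (hderiv t ⟨ht.1, ht.2.le⟩).hasDerivWithinAt)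
    (by simp [hJ, h0, h1, funext_iff])
    (fun t ht => (bound t ⟨ht.1, ht.2.le⟩).trans (mul_le_mul_of_nonneg_right
      ((le_abs_self _).trans (hK t ⟨ht.1, ht.2.le⟩)) (norm_nonneg _)))
    1 ⟨zero_le_one, le_rfl⟩
  simpa [hJ] using congrArg Prod.fst hzero

end IsStaticOn

/-! ### Passage to charts -/

section Charts

variable {M : Type*} [TopologicalSpace M] [ChartedSpace (Coord n) M]
  {e : OpenPartialHomeomorph M (Coord n)}

theorem sum_smul_coordVec (y : Coord n) (x : Fin n → ℝ) :
    ∑ i, x i • coordVec e i y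
      = mfderiv (𝓡 n) (𝓡 n) e.symm y (WithLp.toLp 2 x : Coord n) := by
  have hv : (WithLp.toLp 2 x : Coord n) = ∑ i, x i • (EuclideanSpace.single i 1 : Coord n) := by
    simpa using ((EuclideanSpace.basisFun (Fin n) ℝ).sum_repr (WithLp.toLp 2 x)).symm
  rw [hv]
  refine Eq.symm ((map_sum (mfderiv (𝓡 n) (𝓡 n) e.symm y) _ _).trans ?_)
  exact Finset.sum_congr rfl fun i _ => map_smul _ _ _

theorem mfderiv_symm_injective (he : e ∈ IsManifold.maximalAtlas (𝓡 n) ∞ M) {y : Coord n}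
    (hy : y ∈ e.target) : Function.Injective (mfderiv (𝓡 n) (𝓡 n) e.symm y) := by
  have hd : e.MDifferentiable (𝓡 n) (𝓡 n) :=
    ⟨(contMDiffOn_of_mem_maximalAtlas he).mdifferentiableOn (by simp),
      (contMDiffOn_symm_of_mem_maximalAtlas he).mdifferentiableOn (by simp)⟩
  have := hd.comp_symm_deriv hy
  intro v w hvw
  have hv := congrArg (fun L => L v) this
  have hw := congrArg (fun L => L w) this
  simp only [ContinuousLinearMap.comp_apply] at hv hw
  rw [hvw] at hv
  exact hv.symm.trans hw

variable [IsManifold (𝓡 n) ∞ M]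

/-- The coordinate field is the tangent map of the inverse chart applied to a constant vector field.
-/
theorem contMDiffOn_coordVec (he : e ∈ IsManifold.maximalAtlas (𝓡 n) ∞ M) (i : Fin n) :
    ContMDiffOn (𝓡 n) (𝓡 n).tangent ∞
      (fun y => (⟨e.symm y, coordVec e i y⟩ : TangentBundle (𝓡 n) M)) e.target := by
  have h1 := (contMDiffOn_symm_of_mem_maximalAtlas he).contMDiffOn_tangentMapWithin (m := ∞)
    (by simp) e.open_target.uniqueMDiffOn
  have h2 : ContMDiff (𝓡 n) (𝓡 n).tangent ∞ (fun y : Coord n =>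
      (⟨y, (EuclideanSpace.single i 1 : Coord n)⟩ : TangentBundle (𝓡 n) (Coord n))) :=
    contMDiff_vectorSpace_iff_contDiff.mpr contDiff_const
  refine (h1.comp h2.contMDiffOn (fun y hy => hy)).congr fun y hy => ?_
  simp only [Function.comp, tangentMapWithin, coordVec,
    mfderivWithin_of_isOpen e.open_target hy]

theorem smooth_metricIn (g : Metric n M) (he : e ∈ IsManifold.maximalAtlas (𝓡 n) ∞ M) :
    SmoothMOn e.target (metricIn g e) := by
  intro a b
  have hs := contMDiffOn_symm_of_mem_maximalAtlas he
  have : ContMDiffOn (𝓡 n) ((𝓡 n).prod 𝓘(ℝ)) ∞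
      (fun y => TotalSpace.mk' ℝ (E := Bundle.Trivial M ℝ) (e.symm y)
        (g.inner (e.symm y) (coordVec e a y) (coordVec e b y))) e.target := by
    apply ContMDiffOn.clm_bundle_apply₂ (F₁ := Coord n) (F₂ := Coord n)
    · exact g.contMDiff.comp_contMDiffOn hs
    · exact contMDiffOn_coordVec he a
    · exact contMDiffOn_coordVec he b
  intro y hy
  have := this y hy
  simp only [contMDiffWithinAt_totalSpace] at this
  exact this.2.contDiffWithinAt

theorem isMetricOn_metricIn (g : Metric n M) (he : e ∈ IsManifold.maximalAtlas (𝓡 n) ∞ M) :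
    IsMetricOn e.target (metricIn g e) where
  isOpen := e.open_target
  smooth := smooth_metricIn g he
  posDef := by
    intro y hy
    refine Matrix.PosDef.of_dotProduct_mulVec_pos ?_ ?_
    · ext i j
      exact g.symm _ _ _
    · intro x hx
      have hne : ∑ i, x i • coordVec e i y ≠ 0 := by
        rw [sum_smul_coordVec]
        intro h0
        have := mfderiv_symm_injective he hy (h0.trans (map_zero _).symm)
        exact hx (congrArg WithLp.ofLp this)
      refine (g.pos _ _ hne).trans_eq ?_
      simp only [map_sum, map_smul, _root_.sum_apply, _root_.smul_apply,
        dotProduct, Matrix.mulVec, metricIn, Matrix.of_apply, Pi.star_apply, star_trivial,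
        smul_eq_mul, Finset.mul_sum]
      rw [Finset.sum_comm]
      refine Finset.sum_congr rfl fun i _ => Finset.sum_congr rfl fun j _ => ?_
      ring

theorem isStaticOn_chart {g : Metric n M} {f : M → ℝ} (hf : IsVacuumStatic g f)
    (he : e ∈ IsManifold.maximalAtlas (𝓡 n) ∞ M) :
    IsStaticOn e.target (metricIn g e) (funIn f e) where
  toIsMetricOn := isMetricOn_metricIn g he
  smooth_fun := contMDiffOn_iff_contDiffOn.mp
    (hf.smooth.comp_contMDiffOn (contMDiffOn_symm_of_mem_maximalAtlas he))
  static := fun y hy i j => sub_eq_zero.mp (hf.static e he y hy i j)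

/-- The zero set of a static potential has empty interior. -/
theorem IsVacuumStatic.interior_zero_eq_empty [ConnectedSpace M] {g : Metric n M} {f : M → ℝ}
    (hf : IsVacuumStatic g f) : interior {x | f x = 0} = ∅ := by
  have hclosed : IsClosed (interior {x | f x = 0}) := by
    -- Around a limit point x, take a chart ball; it contains the image of a point x₀ near which f
    -- vanishes, so the 1-jet is zero there. The ball is convex, so segments from x₀ carry f = 0 to
    -- all of it.
    refine isClosed_of_closure_subset fun x hx => ?_
    set e := chartAt (Coord n) x with hedef
    have he : e ∈ IsManifold.maximalAtlas (𝓡 n) ∞ M := IsManifold.chart_mem_maximalAtlas x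
    have h := isStaticOn_chart hf he
    have hxs : x ∈ e.source := mem_chart_source _ x
    obtain ⟨ε, hε, hball⟩ := Metric.isOpen_iff.mp e.open_target (e x) (e.map_source hxs)
    set B : Set M := e.source ∩ e ⁻¹' Metric.ball (e x) ε with hB
    have hBo : IsOpen B := e.isOpen_inter_preimage Metric.isOpen_ball
    obtain ⟨x₀, hx₀B, hx₀⟩ := mem_closure_iff.mp hx B hBo ⟨hxs, Metric.mem_ball_self hε⟩
    refine mem_interior.mpr ⟨B, fun x₁ hx₁ => ?_, hBo, hxs, Metric.mem_ball_self hε⟩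
    set V : Set (Coord n) := e.target ∩ e.symm ⁻¹' interior {x | f x = 0} with hV
    have hVo : IsOpen V := e.symm.isOpen_inter_preimage isOpen_interior
    have hx₀V : e x₀ ∈ V := ⟨e.map_source hx₀B.1, by
      rw [Set.mem_preimage, e.left_inv hx₀B.1]; exact hx₀⟩
    have hfV : ∀ y ∈ V, funIn f e y = 0 := fun y hy =>
      show f (e.symm y) = 0 from interior_subset (s := {x | f x = 0}) hy.2
    have := h.eq_zero_of_segment (x := e x₀) (v := e x₁ - e x₀) (fun t ht => hball ?_)
      (hfV _ hx₀V) (fun i => pd_eq_zero_of_on hVo hfV hx₀V i)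
    · rw [add_sub_cancel, funIn, e.left_inv hx₁.1] at this
      exact this
    · exact (convex_ball _ _).add_smul_sub_mem hx₀B.2 hx₁.2 ht
  rcases isClopen_iff.mp ⟨hclosed, isOpen_interior⟩ with h | h
  · exact h
  · obtain ⟨x, hx⟩ := hf.nontrivial
    exact absurd (interior_subset (h ▸ Set.mem_univ x : x ∈ interior {x | f x = 0})) hx

end Charts

end StaticSpace

/-- For a vacuum static space `T = 0` already forces `B = 0` and `C = 0` locally: on the dense set
where `f ≠ 0`, either `df = 0` and the metric is Ricci flat, or `z` is determined by `df` and the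
metric. The condition on the complete divergence of `B` is then automatic. -/
theorem proposition4 {n : ℕ} (hn : 3 ≤ n) {M : Type*} [TopologicalSpace M]
    [ChartedSpace (StaticSpace.Coord n) M] [IsManifold (𝓡 n) ∞ M] [ConnectedSpace M]
    (g : StaticSpace.Metric n M) (f : M → ℝ) (hf : StaticSpace.IsVacuumStatic g f)
    (hB : StaticSpace.DivDivBachVanishes g) (hT : StaticSpace.TensorTVanishes g f) :
    StaticSpace.BachVanishes g ∧ StaticSpace.CottonVanishes g := by
  have key : ∀ e ∈ IsManifold.maximalAtlas (𝓡 n) ∞ M, ∀ y ∈ e.target,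
      (∀ i j, StaticSpace.bach (StaticSpace.metricIn g e) i j y = 0)
        ∧ ∀ i j k, StaticSpace.cotton (StaticSpace.metricIn g e) i j k y = 0 := by
    intro e he y hy
    refine (StaticSpace.isStaticOn_chart hf he).cotton_and_bach_eq_zero hn ?_ (hT e he) hy
    intro V hVU hV hne
    -- If f vanished on an open piece of the chart, its zero set in M would have interior.
    by_contra hcon
    push Not at hcon
    have ho : IsOpen (e.source ∩ e ⁻¹' V) := e.isOpen_inter_preimage hV
    obtain ⟨y₁, hy₁⟩ := hne
    have hmem : e.symm y₁ ∈ interior {x | f x = 0} := by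
      refine mem_interior.mpr ⟨_, fun x hx => ?_, ho, e.map_target (hVU hy₁), ?_⟩
      · have := hcon _ hx.2
        rwa [StaticSpace.funIn, e.left_inv hx.1] at this
      · rw [Set.mem_preimage, e.right_inv (hVU hy₁)]
        exact hy₁
    rw [hf.interior_zero_eq_empty] at hmem
    exact hmem
  exact ⟨fun e he y hy => (key e he y hy).1, fun e he y hy => (key e he y hy).2⟩
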